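/- **Conventions.** Let $\Sigma$ be a $\lambda$-signature: sort symbols, function symbols $f:s_1\times\dots\times s_n\to s_0$, relation symbols $r:s_1\times\dots\times s_n$, and axiom symbols decorated by closed types (the axiom symbols play no role here). There are countably many variables of each sort. The *$\lambda$-types* over $\Sigma$ are generated by $0$, $1$, $r(t_1,\dots,t_n)$ with $r$ a relation symbol and the $t_i$ logical terms, $A\times B$, $A+B$, $A\to B$, $\forall x{:}s.\,A$, $\exists x{:}s.\,A$. They are identified with the first-order formulae over $\Sigma$, reading $0,1,\times,+,\to$ as $\bot,\top,\wedge,\vee,\supset$. $A[t/x]$ is capture-avoiding substitution. **The category $\Sigma$-Str.** Let $\mathbb D$ be a category and $K:\lambda\mathrm{Types}(\Sigma)\to\mathrm{Obj}\,\mathbb D$ a map. Let $\mathbb D_{\forall x:s.A}$ be the category whose objects are the cones on the family $(K(A[t/x]))_t$, with $t$ ranging over the logical terms of sort $s$, whose vertex is of the form $KB$ with $x\notin\mathrm{FV}(B)$, and whose arrows are the identities and the arrows of cones into a cone with vertex $K(\forall x{:}s.A)$. Dually, let $\mathbb D_{\exists x:s.A}$ be the category whose objects are the co-cones on the same family whose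 vertex is of that form, and whose arrows are the identities and the arrows of co-cones out of a co-cone with vertex $K(\exists x{:}s.A)$. The pair $\langle\mathbb D,K\rangle$ is *logically distributive* if 1. $\mathbb D$ has finite products; 2. $\mathbb D$ has finite co-products; 3. $\mathbb D$ has exponentiation; 4. $\mathbb D$ is distributive: the canonical arrow $(X\times Y)+(X\times Z)\to X\times(Y+Z)$ is always an isomorphism; 5. every $\mathbb D_{\forall x:s.A}$ has a terminal object and every $\mathbb D_{\exists x:s.A}$ has an initial object; 6. $K0$ is initial, $K1$ is terminal, $K(A\times B)$, $K(A+B)$, $K(A\to B)$ are the product, co-product and exponential of $KA$ and $KB$, $K(\forall x{:}s.A)$ is the vertex of the terminal object of $\mathbb D_{\forall x:s.A}$ and $K(\exists x{:}s.A)$ is the vertex of the initial object of $\mathbb D_{\exists x:s.A}$; 7. if $x\notin\mathrm{FV}(A)$, then the unique arrow $K(\exists x{:}s.A\times B)\to KA\times K(\exists x{:}s.B)$ in $\mathbb D_{\exists x:s.A\times B}$, the codomain being a co-cone through the arrows $1\times\delta_t$ with $\delta_t:K(B[t/x])\to K(\exists x{:}s.B)$ the arrows of the initial co-cone, has an inverse.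 The objects of $\Sigma$-Str are the logically distributive $\langle\mathbb D,K\rangle$ with $\mathrm{Obj}\,\mathbb D\subseteq\lambda\mathrm{Types}(\Sigma)$ and $K$ surjective. The arrows $\langle\mathbb D,K\rangle\to\langle\mathbb E,H\rangle$, called *$\Sigma$-homomorphisms*, are the functors $F:\mathbb D\to\mathbb E$ with $F(K\phi)=H\phi$ for each $\lambda$-type $\phi$ that preserve finite products, finite co-products, exponentials, the terminal objects of the categories $\mathbb D_{\forall x:s.A}$ and the initial objects of the categories $\mathbb D_{\exists x:s.A}$. **The category $\Sigma$-H-Str$(\mathbb C)$.** A *Heyting category* is a category with finite limits, pullback-stable images, pullback-stable finite joins of sub-objects, and right adjoints $\forall_f$ of all pullback maps $f^*$ between posets of sub-objects. A *Heyting functor* preserves finite limits, images, finite joins of sub-objects and the $\forall_f$. Fix a Heyting category $\mathbb C$. A $\Sigma$-H-structure $M$ in $\mathbb C$ assigns to each sort $s$ an object $Ms$, to each $f:s_1\times\dots\times s_n\to s_0$ an arrow $Ms_1\times\dots\times Ms_n\to Ms_0$, and to each $r:s_1\times\dots\times s_n$ a sub-object of $Ms_1\times\dots\times Ms_n$. For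 a context $\vec x\equiv x_1{:}s_1,\dots,x_n{:}s_n$ containing $\mathrm{FV}(\phi)$, let $\llbracket\vec x.\phi\rrbracket_M$ be the usual interpretation of $\phi$, a sub-object of $M\vec x=Ms_1\times\dots\times Ms_n$. All $\Sigma$-H-structures considered have inhabited sorts: for each sort $s$ the image of $Ms\to1$ is $1$, i.e. $\exists x{:}s.\top$ is valid in $M$. The objects of $\Sigma$-H-Str$(\mathbb C)$ are these structures. The arrows $M\to N$, called *$\Sigma$-H-homomorphisms*, are the Heyting functors $h:\mathbb C\to\mathbb C$ with $h(\llbracket\vec x.\phi\rrbracket_M)=\llbracket\vec x.\phi\rrbracket_N$ for each formula-in-context; in particular $h(Ms)=Ns$. **The map LD.** For $M$ in $\Sigma$-H-Str$(\mathbb C)$, $\mathrm{LD}(M)=\langle\mathbb D,K\rangle$, where the objects of $\mathbb D$ are the sub-objects-in-context $K\phi=\llbracket\mathrm{FV}(\phi).\phi\rrbracket_M$ (each of them named by one of the $\lambda$-types defining it, so that $\mathrm{Obj}\,\mathbb D\subseteq\lambda\mathrm{Types}(\Sigma)$), and there is at most one arrow $K\phi\to K\psi$, which exists exactly when $\llbracket\mathrm{FV}(\phi)\cup\mathrm{FV}(\psi).\phi\rrbracket_M\le\llbracket\mathrm{FV}(\phi)\cup\mathrm{FV}(\psi).\psi\rrbracket_M$.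 For a $\Sigma$-H-homomorphism $h:M\to N$, $\mathrm{LD}(h)$ maps the object $\llbracket\mathrm{FV}(\phi).\phi\rrbracket_M$ to $h(\llbracket\mathrm{FV}(\phi).\phi\rrbracket_M)$, and an arrow $K\phi\to K\psi$ to the only arrow between the images. **Proposition 8.20.** For every $\lambda$-signature $\Sigma$ and every Heyting category $\mathbb C$, $\mathrm{LD}$ is a functor $\Sigma\text{-H-Str}(\mathbb C)\to\Sigma\text{-Str}$. That is, each $\mathrm{LD}(M)$ is an object of $\Sigma$-Str, each $\mathrm{LD}(h)$ is well defined and a $\Sigma$-homomorphism $\mathrm{LD}(M)\to\mathrm{LD}(N)$, and $\mathrm{LD}$ preserves identities and composition. -/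

import Mathlib

open CategoryTheory CategoryTheory.Limits

universe u v w r u₁ v₁

/-! ### Signatures, logical terms, λ-types -/

/-- A (many-sorted, first-order) logical signature. -/
structure LogicalSignature where
  /-- sort symbols -/
  Srt : Type w
  /-- function symbols, decorated as `f : s₁ × ⋯ × sₙ → s₀` -/
  Fn : Type w
  fnArity : Fn → ℕ
  fnDom : ∀ f : Fn, Fin (fnArity f) → Srt
  fnCod : Fn → Srt
  /-- relation symbols, decorated as `r : s₁ × ⋯ × sₙ` -/
  Rel : Type w
  relArity : Rel → ℕ
  relDom : ∀ r : Rel, Fin (relArity r) → Srt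

/-- Typed variables `x : s`; each sort has the denumerable set `ℕ` of variables. -/
structure TVar (S : Type w) where
  sort : S
  idx : ℕ

noncomputable instance {S : Type w} : DecidableEq (TVar S) := Classical.decEq _

/-- Logical terms of each sort. -/
inductive LTerm (Sg : LogicalSignature.{w}) : Sg.Srt → Type w
  | var (v : TVar Sg.Srt) : LTerm Sg v.sort
  | app (f : Sg.Fn) (args : ∀ i, LTerm Sg (Sg.fnDom f i)) : LTerm Sg (Sg.fnCod f)

/-- λ-types; they are identified with the logical formulae, reading
`0, 1, ×, +, →` as `⊥, ⊤, ∧, ∨, ⊃`. -/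
inductive LType (Sg : LogicalSignature.{w}) : Type w
  | zero : LType Sg
  | one : LType Sg
  | rel (r : Sg.Rel) (args : ∀ i, LTerm Sg (Sg.relDom r i)) : LType Sg
  | prod (A B : LType Sg) : LType Sg
  | sum (A B : LType Sg) : LType Sg
  | arr (A B : LType Sg) : LType Sg
  | all (x : TVar Sg.Srt) (A : LType Sg) : LType Sg
  | ex (x : TVar Sg.Srt) (A : LType Sg) : LType Sg

section Definitions

variable {Sg : LogicalSignature.{w}}

/-- Substitutions of logical variables. -/
abbrev LSubst (Sg : LogicalSignature.{w}) := ∀ v : TVar Sg.Srt, LTerm Sg v.sort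

namespace LTerm

/-- Free variables of a logical term. -/
noncomputable def FV : ∀ {s : Sg.Srt}, LTerm Sg s → Finset (TVar Sg.Srt)
  | _, var v => {v}
  | _, app _ args => Finset.univ.biUnion fun i => (args i).FV

/-- Simultaneous substitution in a logical term. -/
def subst (σ : LSubst Sg) : ∀ {s : Sg.Srt}, LTerm Sg s → LTerm Sg s
  | _, var v => σ v
  | _, app f args => app f fun i => (args i).subst σ

theorem subst_eq_self {s : Sg.Srt} (t : LTerm Sg s) (σ : LSubst Sg)
    (h : ∀ v ∈ t.FV, σ v = var v) : t.subst σ = t := by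
  induction t with
  | var v => exact h v (by simp [FV])
  | app f args ih =>
    simp only [subst]
    congr 1
    funext i
    exact ih i fun v hv => h v (by simp only [FV, Finset.mem_biUnion]; exact ⟨i, by simp, hv⟩)

end LTerm

namespace LType

/-- Free variables of a λ-type. -/
noncomputable def FV : LType Sg → Finset (TVar Sg.Srt)
  | zero => ∅
  | one => ∅
  | rel _ args => Finset.univ.biUnion fun i => (args i).FV
  | prod A B => A.FV ∪ B.FV
  | sum A B => A.FV ∪ B.FV
  | arr A B => A.FV ∪ B.FV
  | all x A => A.FV.erase x
  | ex x A => A.FV.erase x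

/-- The name of a bound variable after a substitution whose terms have free variables in `F`:
`x` is kept if this captures nothing, and is replaced by a new variable of the same sort
otherwise. -/
noncomputable def boundName (x : TVar Sg.Srt) (F : Finset (TVar Sg.Srt)) : ℕ :=
  if x ∈ F then F.sup TVar.idx + 1 else x.idx

/-- Capture-avoiding simultaneous substitution in a λ-type. -/
noncomputable def subst : LType Sg → LSubst Sg → LType Sg
  | zero, _ => zero
  | one, _ => one
  | rel r args, σ => rel r fun i => (args i).subst σ
  | prod A B, σ => prod (A.subst σ) (B.subst σ)
  | sum A B, σ => sum (A.subst σ) (B.subst σ)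
  | arr A B, σ => arr (A.subst σ) (B.subst σ)
  | all x A, σ =>
      let z : TVar Sg.Srt := ⟨x.sort, boundName x ((A.FV.erase x).biUnion fun v => (σ v).FV)⟩
      all z (A.subst (Function.update σ x (LTerm.var z)))
  | ex x A, σ =>
      let z : TVar Sg.Srt := ⟨x.sort, boundName x ((A.FV.erase x).biUnion fun v => (σ v).FV)⟩
      ex z (A.subst (Function.update σ x (LTerm.var z)))

/-- `A[t/x]`. -/
noncomputable def inst (A : LType Sg) (x : TVar Sg.Srt) (t : LTerm Sg x.sort) : LType Sg :=
  A.subst (Function.update LTerm.var x t)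

theorem boundName_eq (x : TVar Sg.Srt) (A : LType Sg) (σ : LSubst Sg)
    (h : ∀ v ∈ A.FV.erase x, σ v = LTerm.var v) :
    boundName x ((A.FV.erase x).biUnion fun v => (σ v).FV) = x.idx := by
  unfold boundName
  rw [if_neg]
  intro hx
  rw [Finset.mem_biUnion] at hx
  obtain ⟨v, hv, hxv⟩ := hx
  rw [h v hv] at hxv
  simp only [LTerm.FV, Finset.mem_singleton] at hxv
  subst hxv
  simp at hv

theorem subst_eq_self (A : LType Sg) : ∀ (σ : LSubst Sg),
    (∀ v ∈ A.FV, σ v = LTerm.var v) → A.subst σ = A := by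
  induction A with
  | zero => intros; rfl
  | one => intros; rfl
  | rel r args =>
    intro σ h
    simp only [subst]
    congr 1
    funext i
    exact (args i).subst_eq_self σ fun v hv =>
      h v (by simp only [FV, Finset.mem_biUnion]; exact ⟨i, by simp, hv⟩)
  | prod A B ihA ihB | sum A B ihA ihB | arr A B ihA ihB =>
    intro σ h
    simp only [subst]
    rw [ihA σ fun v hv => h v (by simp [FV, hv]), ihB σ fun v hv => h v (by simp [FV, hv])]
  | all x A ih | ex x A ih =>
    intro σ h
    simp only [subst]
    rw [boundName_eq x A σ h, ih]
    intro v hv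
    by_cases hvx : v = x
    · subst hvx; simp
    · rw [Function.update_of_ne hvx]
      exact h v (by simp [FV, hv, hvx])

/-- If `x` is not free in `A`, then `A[t/x] = A`. -/
theorem inst_eq_self (A : LType Sg) (x : TVar Sg.Srt) (t : LTerm Sg x.sort) (hx : x ∉ A.FV) :
    A.inst x t = A :=
  A.subst_eq_self _ fun v hv => Function.update_of_ne (by rintro rfl; exact hx hv) _ _

end LType

/-- A λ-signature: a logical signature with axiom symbols decorated by closed types `A → B`. -/
structure LambdaSignature extends LogicalSignature.{w} where
  Ax : Type w
  axDom : Ax → LType toLogicalSignature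
  axCod : Ax → LType toLogicalSignature
  ax_closed : ∀ a, ((axDom a).arr (axCod a)).FV = ∅

/-! ### Logically distributive categories -/

section LogDist

variable {D : Type u₁} [Category.{v₁} D]

/-- `E`, with evaluation `ev : A × E ⟶ B`, is an exponential `B ^ A`. Here `P`, with projections
`p` and `q`, is the product `A × E`; the arrow `m` below is `1_A × g`. -/
structure IsExponential {A B E P : D} (p : P ⟶ A) (q : P ⟶ E) (ev : P ⟶ B) : Prop where
  isProduct : Nonempty (IsLimit (BinaryFan.mk p q))
  existsUnique : ∀ (X Q : D) (a : Q ⟶ A) (x : Q ⟶ X), Nonempty (IsLimit (BinaryFan.mk a x)) →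
    ∀ f : Q ⟶ B, ∃! g : X ⟶ E, ∀ m : Q ⟶ P, m ≫ p = a → m ≫ q = x ≫ g → m ≫ ev = f

/-- The objects of `𝔻_(∀x:s.A)`: the cones on the family `t ↦ M (A[t/x])`, `t` a logical term of
sort `s`, whose vertex is of the form `M B` with `x` not free in `B`. -/
structure ForallObj (M : LType Sg → D) (x : TVar Sg.Srt) (A : LType Sg) where
  pt : D
  form : ∃ B : LType Sg, x ∉ B.FV ∧ M B = pt
  leg : ∀ t : LTerm Sg x.sort, pt ⟶ M (A.inst x t)

/-- The arrows of `𝔻_(∀x:s.A)`: the identities, and the arrows of cones with codomain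
`M (∀x:s.A)`. -/
@[ext]
structure ForallHom {M : LType Sg → D} {x : TVar Sg.Srt} {A : LType Sg}
    (X Y : ForallObj M x A) where
  hom : X.pt ⟶ Y.pt
  w : ∀ t, hom ≫ Y.leg t = X.leg t
  star : (∃ h : X = Y, hom = eqToHom (congrArg ForallObj.pt h)) ∨ Y.pt = M (.all x A)

instance (M : LType Sg → D) (x : TVar Sg.Srt) (A : LType Sg) : Category (ForallObj M x A) where
  Hom X Y := ForallHom X Y
  id X := ⟨𝟙 _, by simp, .inl ⟨rfl, rfl⟩⟩
  comp {X Y Z} f g := ⟨f.hom ≫ g.hom, by simp [f.w, g.w], by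
    rcases g.star with ⟨rfl, h⟩ | h
    · rcases f.star with ⟨rfl, h'⟩ | h'
      · exact .inl ⟨rfl, by simp [h, h']⟩
      · exact .inr h'
    · exact .inr h⟩
  id_comp _ := by ext; simp
  comp_id _ := by ext; simp
  assoc _ _ _ := by ext; simp

/-- The objects of `𝔻_(∃x:s.A)`: the co-cones on the family `t ↦ M (A[t/x])`, `t` a logical term
of sort `s`, whose vertex is of the form `M B` with `x` not free in `B`. -/
structure ExistsObj (M : LType Sg → D) (x : TVar Sg.Srt) (A : LType Sg) where
  pt : D
  form : ∃ B : LType Sg, x ∉ B.FV ∧ M B = pt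
  leg : ∀ t : LTerm Sg x.sort, M (A.inst x t) ⟶ pt

/-- The arrows of `𝔻_(∃x:s.A)`: the identities, and the arrows of co-cones with domain
`M (∃x:s.A)`. -/
@[ext]
structure ExistsHom {M : LType Sg → D} {x : TVar Sg.Srt} {A : LType Sg}
    (X Y : ExistsObj M x A) where
  hom : X.pt ⟶ Y.pt
  w : ∀ t, X.leg t ≫ hom = Y.leg t
  star : (∃ h : X = Y, hom = eqToHom (congrArg ExistsObj.pt h)) ∨ X.pt = M (.ex x A)

instance (M : LType Sg → D) (x : TVar Sg.Srt) (A : LType Sg) : Category (ExistsObj M x A) where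
  Hom X Y := ExistsHom X Y
  id X := ⟨𝟙 _, by simp, .inl ⟨rfl, rfl⟩⟩
  comp {X Y Z} f g := ⟨f.hom ≫ g.hom, fun t => by rw [← Category.assoc, f.w, g.w], by
    rcases f.star with ⟨rfl, h⟩ | h
    · rcases g.star with ⟨rfl, h'⟩ | h'
      · exact .inl ⟨rfl, by simp [h, h']⟩
      · exact .inr h'
    · exact .inr h⟩
  id_comp _ := by ext; simp
  comp_id _ := by ext; simp
  assoc _ _ _ := by ext; simp

/-- The structure witnessing that `D` with `M : λTypes(Σ) → Obj D` is logically distributive. -/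
structure LogDistStructure (M : LType Sg → D) where
  /- `D` has finite products, finite co-products, exponentiation, and is distributive. -/
  [hasFiniteProducts : HasFiniteProducts D]
  [hasFiniteCoproducts : HasFiniteCoproducts D]
  hasExponentials : ∀ A B : D, ∃ (E P : D) (p : P ⟶ A) (q : P ⟶ E) (ev : P ⟶ B),
    IsExponential p q ev
  distributive : ∀ A B C : D, IsIso (coprod.desc (prod.map (𝟙 A) coprod.inl)
    (prod.map (𝟙 A) coprod.inr) : (A ⨯ B) ⨿ (A ⨯ C) ⟶ A ⨯ (B ⨿ C))
  /- `M 0` is initial and `M 1` is terminal. -/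
  zero : IsInitial (M .zero)
  one : IsTerminal (M .one)
  /- `M (A × B)` is the product of `M A` and `M B`. -/
  fst : ∀ A B, M (.prod A B) ⟶ M A
  snd : ∀ A B, M (.prod A B) ⟶ M B
  prod : ∀ A B, IsLimit (BinaryFan.mk (fst A B) (snd A B))
  /- `M (A + B)` is the co-product of `M A` and `M B`. -/
  inl : ∀ A B, M A ⟶ M (.sum A B)
  inr : ∀ A B, M B ⟶ M (.sum A B)
  sum : ∀ A B, IsColimit (BinaryCofan.mk (inl A B) (inr A B))
  /- `M (A → B)` is the exponential of `M A` and `M B`. -/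
  ev : ∀ A B, M (.prod A (.arr A B)) ⟶ M B
  arr : ∀ A B, IsExponential (fst A (.arr A B)) (snd A (.arr A B)) (ev A B)
  /- `M (∀x:s.A)` is the terminal object of `𝔻_(∀x:s.A)`, which in particular has one. -/
  all : ∀ x A, ForallObj M x A
  all_pt : ∀ x A, (all x A).pt = M (.all x A)
  all_isTerminal : ∀ x A, IsTerminal (all x A)
  /- `M (∃x:s.A)` is the initial object of `𝔻_(∃x:s.A)`, which in particular has one. -/
  ex : ∀ x A, ExistsObj M x A
  ex_pt : ∀ x A, (ex x A).pt = M (.ex x A)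
  ex_isInitial : ∀ x A, IsInitial (ex x A)
  /- If `x` is not free in `A`, then `M A × M (∃x:s.B)`, with the arrows
  `1 × δ_t : M ((A × B)[t/x]) = M A × M (B[t/x]) ⟶ M A × M (∃x:s.B)`, is an object of
  `𝔻_(∃x:s.A×B)`, and the unique arrow to it from `M (∃x:s.A×B)` has an inverse. -/
  ex_distrib : ∀ (x : TVar Sg.Srt) (A B : LType Sg) (hx : x ∉ A.FV) (Y : ExistsObj M x (.prod A B)),
    ∀ hY : Y.pt = M (.prod A (.ex x B)),
    (∀ t : LTerm Sg x.sort,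
      Y.leg t ≫ eqToHom hY ≫ fst A (.ex x B) =
        fst (A.inst x t) (B.inst x t) ≫ eqToHom (congrArg M (A.inst_eq_self x t hx)) ∧
      Y.leg t ≫ eqToHom hY ≫ snd A (.ex x B) =
        snd (A.inst x t) (B.inst x t) ≫ (ex x B).leg t ≫ eqToHom (ex_pt x B)) →
    IsIso ((ex_isInitial x (.prod A B)).to Y).hom

/-- `D` with `M : λTypes(Σ) → Obj D` is a logically distributive category. -/
def IsLogicallyDistributive (M : LType Sg → D) : Prop := Nonempty (LogDistStructure M)

end LogDist

/-- The objects of `Σ-Str`: the logically distributive categories `⟨𝔻, M⟩` such that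
`Obj 𝔻 ⊆ λTypes(Σ)` and `M` is surjective. -/
structure SigmaStr (Sg : LogicalSignature.{w}) where
  Obj : Set (LType Sg)
  [cat : Category.{r} Obj]
  M : LType Sg → Obj
  surjective : Function.Surjective M
  isLogicallyDistributive : IsLogicallyDistributive M

attribute [instance] SigmaStr.cat

namespace SigmaStr

/-- The image of a cone in `𝔻_(∀x:s.A)` under a functor compatible with the maps `M`. -/
noncomputable def mapForall {X Y : SigmaStr.{w, r} Sg} (F : X.Obj ⥤ Y.Obj) (hF : ∀ A, F.obj (X.M A) = Y.M A)
    {x : TVar Sg.Srt} {A : LType Sg} (c : ForallObj X.M x A) : ForallObj Y.M x A where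
  pt := F.obj c.pt
  form := by
    obtain ⟨B, hB, h⟩ := c.form
    exact ⟨B, hB, by rw [← h, hF]⟩
  leg t := F.map (c.leg t) ≫ eqToHom (hF _)

/-- The image of a co-cone in `𝔻_(∃x:s.A)` under a functor compatible with the maps `M`. -/
noncomputable def mapExists {X Y : SigmaStr.{w, r} Sg} (F : X.Obj ⥤ Y.Obj) (hF : ∀ A, F.obj (X.M A) = Y.M A)
    {x : TVar Sg.Srt} {A : LType Sg} (c : ExistsObj X.M x A) : ExistsObj Y.M x A where
  pt := F.obj c.pt
  form := by
    obtain ⟨B, hB, h⟩ := c.form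
    exact ⟨B, hB, by rw [← h, hF]⟩
  leg t := eqToHom (hF _).symm ≫ F.map (c.leg t)

/-- Σ-homomorphisms: the functors which commute with the interpretations of the λ-types and
preserve finite products, finite co-products, exponentiation, the terminal objects of the
categories `𝔻_(∀x:s.A)` and the initial objects of the categories `𝔻_(∃x:s.A)`. -/
@[ext]
structure Hom (X Y : SigmaStr.{w, r} Sg) where
  functor : X.Obj ⥤ Y.Obj
  map_M : ∀ A, functor.obj (X.M A) = Y.M A
  preservesFiniteProducts : PreservesFiniteProducts functor
  preservesFiniteCoproducts : PreservesFiniteCoproducts functor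
  map_exponential : ∀ {A B E P : X.Obj} (p : P ⟶ A) (q : P ⟶ E) (ev : P ⟶ B),
    IsExponential p q ev → IsExponential (functor.map p) (functor.map q) (functor.map ev)
  map_terminal : ∀ (x : TVar Sg.Srt) (A : LType Sg) (c : ForallObj X.M x A),
    Nonempty (IsTerminal c) → Nonempty (IsTerminal (mapForall functor map_M c))
  map_initial : ∀ (x : TVar Sg.Srt) (A : LType Sg) (c : ExistsObj X.M x A),
    Nonempty (IsInitial c) → Nonempty (IsInitial (mapExists functor map_M c))

/-- The category `Σ-Str`. -/
instance : Category (SigmaStr.{w, r} Sg) where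
  Hom := Hom
  id X :=
    { functor := 𝟭 _
      map_M := fun _ => rfl
      preservesFiniteProducts := inferInstance
      preservesFiniteCoproducts := inferInstance
      map_exponential := fun _ _ _ h => h
      map_terminal := fun x A c h => by
        have : mapForall (𝟭 X.Obj) (fun _ => rfl) c = c := by cases c; simp [mapForall]
        rwa [this]
      map_initial := fun x A c h => by
        have : mapExists (𝟭 X.Obj) (fun _ => rfl) c = c := by cases c; simp [mapExists]
        rwa [this] }
  comp {X Y Z} F G :=
    { functor := F.functor ⋙ G.functor
      map_M := fun A => by rw [Functor.comp_obj, F.map_M, G.map_M]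
      preservesFiniteProducts := by
        have := F.preservesFiniteProducts
        have := G.preservesFiniteProducts
        infer_instance
      preservesFiniteCoproducts := by
        have := F.preservesFiniteCoproducts
        have := G.preservesFiniteCoproducts
        infer_instance
      map_exponential := fun _ _ _ h => G.map_exponential _ _ _ (F.map_exponential _ _ _ h)
      map_terminal := fun x A c h => by
        have := G.map_terminal x A _ (F.map_terminal x A c h)
        convert this using 2
        simp [mapForall, eqToHom_map]
      map_initial := fun x A c h => by
        have := G.map_initial x A _ (F.map_initial x A c h)
        convert this using 2
        simp [mapExists, eqToHom_map] }

end SigmaStr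

/-! ### Heyting categories -/

/-- Heyting categories: finite limits, images stable under pullback, finite joins of sub-objects
stable under pullback, and right adjoints of the pullback functors between sub-objects. -/
class HeytingCategory (C : Type u) [Category.{v} C] : Prop where
  [hasFiniteLimits : HasFiniteLimits C]
  [hasImages : HasImages C]
  image_stable : ∀ {X Y Z : C} (f : X ⟶ Y) (g : Z ⟶ Y),
    (Subobject.pullback g).obj (imageSubobject f) = imageSubobject (pullback.snd f g)
  exists_bot : ∀ X : C, ∃ B : Subobject X, IsBot B
  exists_sup : ∀ {X : C} (A B : Subobject X), ∃ S : Subobject X, IsLUB {A, B} S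
  bot_stable : ∀ {X Y : C} (f : X ⟶ Y) (B : Subobject Y),
    IsBot B → IsBot ((Subobject.pullback f).obj B)
  sup_stable : ∀ {X Y : C} (f : X ⟶ Y) (A B S : Subobject Y), IsLUB {A, B} S →
    IsLUB {(Subobject.pullback f).obj A, (Subobject.pullback f).obj B}
      ((Subobject.pullback f).obj S)
  exists_forall : ∀ {X Y : C} (f : X ⟶ Y), (Subobject.pullback f).IsLeftAdjoint

attribute [instance] HeytingCategory.hasFiniteLimits HeytingCategory.hasImages
  HeytingCategory.exists_forall

noncomputable section Heyting

variable {C : Type u} [Category.{v} C] [HeytingCategory C]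

/-- `∃_f`, the left adjoint of the pullback functor `f^*` between sub-objects. -/
def exSub {X Y : C} (f : X ⟶ Y) (A : Subobject X) : Subobject Y :=
  haveI : (Subobject.pullback f).IsRightAdjoint := (Subobject.existsPullbackAdj f).isRightAdjoint
  (Subobject.pullback f).leftAdjoint.obj A

/-- `∀_f`, the right adjoint of the pullback functor `f^*` between sub-objects. -/
def allSub {X Y : C} (f : X ⟶ Y) (A : Subobject X) : Subobject Y :=
  (Subobject.pullback f).rightAdjoint.obj A

theorem le_allSub_iff {X Y : C} (f : X ⟶ Y) (A : Subobject X) (B : Subobject Y) :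
    B ≤ allSub f A ↔ (Subobject.pullback f).obj B ≤ A :=
  ⟨fun h => (((Adjunction.ofIsLeftAdjoint (Subobject.pullback f)).homEquiv B A).symm h.hom).le,
   fun h => ((Adjunction.ofIsLeftAdjoint (Subobject.pullback f)).homEquiv B A h.hom).le⟩

/-- The Heyting algebra of sub-objects of an object of a Heyting category. -/
instance (X : C) : HeytingAlgebra (Subobject X) where
  sup A B := (HeytingCategory.exists_sup A B).choose
  le_sup_left A B := (HeytingCategory.exists_sup A B).choose_spec.1 (by simp)
  le_sup_right A B := (HeytingCategory.exists_sup A B).choose_spec.1 (by simp)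
  sup_le A B S hA hB := (HeytingCategory.exists_sup A B).choose_spec.2 (by
    rintro _ (rfl | rfl) <;> assumption)
  bot := (HeytingCategory.exists_bot X).choose
  bot_le := (HeytingCategory.exists_bot X).choose_spec
  le_top _ := le_top
  himp A B := allSub A.arrow ((Subobject.pullback A.arrow).obj B)
  le_himp_iff A B S := by
    rw [le_allSub_iff]
    have key : A ⊓ B ≤ S ↔
        (Subobject.pullback B.arrow).obj A ≤ (Subobject.pullback B.arrow).obj S := by
      rw [inf_comm, Subobject.inf_eq_map_pullback]
      exact ⟨fun h => (((Subobject.mapPullbackAdj B.arrow).homEquiv _ _) h.hom).le,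
        fun h => (((Subobject.mapPullbackAdj B.arrow).homEquiv _ _).symm h.hom).le⟩
    exact key.symm
  compl A := allSub A.arrow
    ((Subobject.pullback A.arrow).obj (HeytingCategory.exists_bot X).choose)
  himp_bot _ := rfl

/-- The image `h(A)` of a sub-object under a functor preserving monomorphisms. -/
def mapSub {D : Type u₁} [Category.{v₁} D] (F : C ⥤ D) [F.PreservesMonomorphisms] {X : C}
    (A : Subobject X) : Subobject (F.obj X) :=
  Subobject.mk (F.map A.arrow)

/-- Heyting functors: they preserve finite limits, images, finite joins of sub-objects, and the
right adjoints of the pullback functors between sub-objects. -/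
class IsHeytingFunctor {D : Type u₁} [Category.{v₁} D] [HeytingCategory D] (F : C ⥤ D) :
    Prop where
  [preservesFiniteLimits : PreservesFiniteLimits F]
  map_image : ∀ {X Y : C} (f : X ⟶ Y), mapSub F (imageSubobject f) = imageSubobject (F.map f)
  map_bot : ∀ X : C, mapSub F (⊥ : Subobject X) = ⊥
  map_sup : ∀ {X : C} (A B : Subobject X), mapSub F (A ⊔ B) = mapSub F A ⊔ mapSub F B
  map_forall : ∀ {X Y : C} (f : X ⟶ Y) (A : Subobject X),
    mapSub F (allSub f A) = allSub (F.map f) (mapSub F A)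

attribute [instance] IsHeytingFunctor.preservesFiniteLimits

theorem mapSub_mk {B : Type u} [Category.{v} B] {D : Type u₁} [Category.{v₁} D] (F : B ⥤ D)
    [F.PreservesMonomorphisms] {X Y : B} (m : Y ⟶ X) [Mono m] :
    mapSub F (Subobject.mk m) = Subobject.mk (F.map m) :=
  Subobject.mk_eq_mk_of_comm _ _ (F.mapIso (Subobject.underlyingIso m))
    (by simp [← Functor.map_comp])

theorem mapSub_comp {B : Type u} [Category.{v} B] (F G : B ⥤ B) [F.PreservesMonomorphisms] [G.PreservesMonomorphisms]
    [(F ⋙ G).PreservesMonomorphisms] {X : B} (A : Subobject X) :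
    mapSub (F ⋙ G) A = mapSub G (mapSub F A) := by
  rw [mapSub.eq_def F, mapSub_mk]
  rfl

instance : IsHeytingFunctor (𝟭 C) where
  map_image f := Subobject.mk_arrow _
  map_bot X := Subobject.mk_arrow _
  map_sup A B := by
    have h : ∀ {X : C} (A : Subobject X), mapSub (𝟭 C) A = A := fun A => Subobject.mk_arrow A
    exact (h _).trans (congrArg₂ (· ⊔ ·) (h A).symm (h B).symm)
  map_forall f A := by
    have h : ∀ {X : C} (A : Subobject X), mapSub (𝟭 C) A = A := fun A => Subobject.mk_arrow A
    exact (h _).trans (congrArg (allSub f) (h A).symm)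

instance (F G : C ⥤ C) [IsHeytingFunctor F] [IsHeytingFunctor G] : IsHeytingFunctor (F ⋙ G) where
  map_image f := by
    rw [mapSub_comp, IsHeytingFunctor.map_image, IsHeytingFunctor.map_image, Functor.comp_map]
  map_bot X := by
    rw [mapSub_comp, IsHeytingFunctor.map_bot]
    exact IsHeytingFunctor.map_bot _
  map_sup A B := by
    rw [mapSub_comp, IsHeytingFunctor.map_sup, IsHeytingFunctor.map_sup, mapSub_comp,
      mapSub_comp]
  map_forall f A := by
    rw [mapSub_comp, IsHeytingFunctor.map_forall, IsHeytingFunctor.map_forall, mapSub_comp,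
      Functor.comp_map]

/-! ### Structures in Heyting categories -/

/-- A Σ-H-structure in the Heyting category `C`. -/
structure HStructure (C : Type u) [Category.{v} C] [HeytingCategory C]
    (Sg : LogicalSignature.{w}) where
  sort : Sg.Srt → C
  fn : ∀ f : Sg.Fn, (∏ᶜ fun i => sort (Sg.fnDom f i)) ⟶ sort (Sg.fnCod f)
  rel : ∀ r : Sg.Rel, Subobject (∏ᶜ fun i => sort (Sg.relDom r i))

/-- An interpretation of the variables of the context `Γ` by arrows with domain `X`. -/
abbrev CtxVal (M : HStructure C Sg) (X : C) (Γ : Finset (TVar Sg.Srt)) :=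
  ∀ v, v ∈ Γ → (X ⟶ M.sort v.sort)

/-- The extension of a valuation along the projection `X × M s ⟶ X`, the (new) variable `x : s`
being interpreted by the projection `X × M s ⟶ M s`. -/
def CtxVal.extend {M : HStructure C Sg} {X : C} {Γ : Finset (TVar Sg.Srt)}
    (ρ : CtxVal M X Γ) (x : TVar Sg.Srt) :
    CtxVal M (X ⨯ M.sort x.sort) (insert x Γ) := fun v hv =>
  if h : v = x then prod.snd ≫ eqToHom (by rw [h])
  else prod.fst ≫ ρ v ((Finset.mem_insert.1 hv).resolve_left h)

/-- The interpretation of a term under a valuation. -/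
def LTerm.eval (M : HStructure C Sg) {X : C} {Γ : Finset (TVar Sg.Srt)} (ρ : CtxVal M X Γ) :
    ∀ {s : Sg.Srt} (t : LTerm Sg s), t.FV ⊆ Γ → (X ⟶ M.sort s)
  | _, .var v, h => ρ v (h (Finset.mem_singleton_self v))
  | _, .app f args, h =>
      Pi.lift (fun i => (args i).eval M ρ
        ((Finset.subset_biUnion_of_mem (fun i => (args i).FV) (Finset.mem_univ i)).trans h)) ≫
      M.fn f

/-- The interpretation of a formula under a valuation, a sub-object of `X`. -/
def LType.eval (M : HStructure C Sg) : ∀ (A : LType Sg) {X : C} {Γ : Finset (TVar Sg.Srt)},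
    CtxVal M X Γ → A.FV ⊆ Γ → Subobject X
  | .zero, _, _, _, _ => ⊥
  | .one, _, _, _, _ => ⊤
  | .rel r args, _, _, ρ, h =>
      (Subobject.pullback (Pi.lift fun i => (args i).eval M ρ
        ((Finset.subset_biUnion_of_mem (fun i => (args i).FV) (Finset.mem_univ i)).trans h))).obj
        (M.rel r)
  | .prod A B, _, _, ρ, h =>
      A.eval M ρ (Finset.union_subset_left h) ⊓ B.eval M ρ (Finset.union_subset_right h)
  | .sum A B, _, _, ρ, h =>
      A.eval M ρ (Finset.union_subset_left h) ⊔ B.eval M ρ (Finset.union_subset_right h)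
  | .arr A B, _, _, ρ, h =>
      A.eval M ρ (Finset.union_subset_left h) ⇨ B.eval M ρ (Finset.union_subset_right h)
  | .all x A, _, _, ρ, h =>
      allSub prod.fst (A.eval M (ρ.extend x) (Finset.subset_insert_iff.2 h))
  | .ex x A, _, _, ρ, h =>
      exSub prod.fst (A.eval M (ρ.extend x) (Finset.subset_insert_iff.2 h))

namespace HStructure

/-- `M(x₁:A₁, …, xₙ:Aₙ) = MA₁ × ⋯ × MAₙ`. -/
abbrev ctx (M : HStructure C Sg) (Γ : Finset (TVar Sg.Srt)) : C :=
  ∏ᶜ fun v : {v // v ∈ Γ} => M.sort v.1.sort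

/-- The projections of `M Γ`. -/
abbrev ctxProj (M : HStructure C Sg) (Γ : Finset (TVar Sg.Srt)) (v : {v // v ∈ Γ}) :
    M.ctx Γ ⟶ M.sort v.1.sort :=
  Pi.π (fun v : {v // v ∈ Γ} => M.sort v.1.sort) v

/-- `⟦Γ. φ⟧`, a sub-object of `M Γ`. -/
def interp (M : HStructure C Sg) (Γ : Finset (TVar Sg.Srt)) (φ : LType Sg) (h : φ.FV ⊆ Γ) :
    Subobject (M.ctx Γ) :=
  φ.eval M (fun v hv => M.ctxProj Γ ⟨v, hv⟩) h

/-- Sub-objects in context: a context `Γ` and a sub-object of `M Γ`. -/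
abbrev CtxSub (M : HStructure C Sg) := Σ Γ : Finset (TVar Sg.Srt), Subobject (M.ctx Γ)

/-- `⟦FV(φ). φ⟧`. -/
def interpFV (M : HStructure C Sg) (φ : LType Sg) : M.CtxSub :=
  ⟨φ.FV, M.interp φ.FV φ (Finset.Subset.refl _)⟩

/-- The canonical arrow `h(M Γ) ⟶ N Γ` when `h(M s) = N s` for each sort `s`. -/
def ctxComparison {M N : HStructure C Sg} (F : C ⥤ C) (hF : ∀ s, F.obj (M.sort s) = N.sort s)
    (Γ : Finset (TVar Sg.Srt)) : F.obj (M.ctx Γ) ⟶ N.ctx Γ :=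
  Pi.lift fun v => F.map (M.ctxProj Γ v) ≫ eqToHom (hF _)

theorem ctxComparison_proj {M N : HStructure C Sg} (F : C ⥤ C)
    (hF : ∀ s, F.obj (M.sort s) = N.sort s) (Γ : Finset (TVar Sg.Srt)) (v : {v // v ∈ Γ}) :
    ctxComparison (M := M) (N := N) F hF Γ ≫ N.ctxProj Γ v =
      F.map (M.ctxProj Γ v) ≫ eqToHom (hF _) :=
  Pi.lift_π _ _

instance {M N : HStructure C Sg} (F : C ⥤ C) [PreservesFiniteLimits F]
    (hF : ∀ s, F.obj (M.sort s) = N.sort s) (Γ : Finset (TVar Sg.Srt)) :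
    IsIso (ctxComparison (M := M) (N := N) F hF Γ) := by
  let e : F.obj (M.ctx Γ) ≅ N.ctx Γ :=
    PreservesProduct.iso F (fun v : {v // v ∈ Γ} => M.sort v.1.sort) ≪≫
      Limits.Pi.mapIso (fun v : {v // v ∈ Γ} => eqToIso (hF v.1.sort))
  have : ctxComparison (M := M) (N := N) F hF Γ = e.hom := by
    apply Pi.hom_ext
    intro v
    rw [ctxComparison_proj]
    simp [e]
  rw [this]
  infer_instance

/-- The sub-object of `N Γ` given by `h(A) ↪ h(M Γ) ≅ N Γ`, for a sub-object `A` of `M Γ`. -/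
def mapCtx {M N : HStructure C Sg} (F : C ⥤ C) [PreservesFiniteLimits F]
    (hF : ∀ s, F.obj (M.sort s) = N.sort s) {Γ : Finset (TVar Sg.Srt)}
    (A : Subobject (M.ctx Γ)) : Subobject (N.ctx Γ) :=
  Subobject.mk (F.map A.arrow ≫ ctxComparison (M := M) (N := N) F hF Γ)

/-- Σ-H-homomorphisms: the Heyting functors `h : C ⥤ C` such that `h(⟦Γ. φ⟧_M) = ⟦Γ. φ⟧_N` for
every formula-in-context; in particular `h(M s) = N s`. -/
@[ext]
structure Hom (M N : HStructure C Sg) where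
  functor : C ⥤ C
  isHeyting : IsHeytingFunctor functor
  map_sort : ∀ s, functor.obj (M.sort s) = N.sort s
  map_interp : ∀ (Γ : Finset (TVar Sg.Srt)) (φ : LType Sg) (h : φ.FV ⊆ Γ),
    mapCtx (N := N) functor map_sort (M.interp Γ φ h) = N.interp Γ φ h

attribute [instance] Hom.isHeyting

theorem mapCtx_mk {M N : HStructure C Sg} (F : C ⥤ C) [PreservesFiniteLimits F]
    (hF : ∀ s, F.obj (M.sort s) = N.sort s) {Γ : Finset (TVar Sg.Srt)} {Y : C}
    (m : Y ⟶ M.ctx Γ) [Mono m] : mapCtx (N := N) F hF (Subobject.mk m) =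
      Subobject.mk (F.map m ≫ ctxComparison (M := M) (N := N) F hF Γ) :=
  Subobject.mk_eq_mk_of_comm _ _ (F.mapIso (Subobject.underlyingIso m))
    (by simp [← Functor.map_comp_assoc])

theorem mapCtx_comp {M N P : HStructure C Sg} (F G : C ⥤ C) [PreservesFiniteLimits F]
    [PreservesFiniteLimits G] (hF : ∀ s, F.obj (M.sort s) = N.sort s)
    (hG : ∀ s, G.obj (N.sort s) = P.sort s) (hFG : ∀ s, (F ⋙ G).obj (M.sort s) = P.sort s)
    {Γ : Finset (TVar Sg.Srt)} (A : Subobject (M.ctx Γ)) :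
    mapCtx (N := P) (F ⋙ G) hFG A = mapCtx (N := P) G hG (mapCtx (N := N) F hF A) := by
  rw [mapCtx.eq_def F, mapCtx_mk, mapCtx]
  congr 1
  rw [Functor.map_comp, Category.assoc]
  congr 1
  apply Pi.hom_ext
  intro v
  change _ ≫ P.ctxProj Γ v = _ ≫ P.ctxProj Γ v
  rw [ctxComparison_proj, Category.assoc, ctxComparison_proj, ← Functor.map_comp_assoc,
    ctxComparison_proj]
  simp [eqToHom_map]

theorem mapCtx_id {M : HStructure C Sg} (h : ∀ s, (𝟭 C).obj (M.sort s) = M.sort s)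
    {Γ : Finset (TVar Sg.Srt)} (A : Subobject (M.ctx Γ)) :
    mapCtx (N := M) (𝟭 C) h A = A := by
  have hc : ctxComparison (M := M) (N := M) (𝟭 C) h Γ = 𝟙 _ := by
    apply Pi.hom_ext
    intro v
    change _ ≫ M.ctxProj Γ v = _ ≫ M.ctxProj Γ v
    rw [ctxComparison_proj]
    simp
  conv_rhs => rw [← Subobject.mk_arrow A]
  rw [mapCtx]
  congr 1
  rw [hc]
  exact Category.comp_id _

/-- The category `Σ-H-Str(C)`. -/
instance : Category (HStructure C Sg) where
  Hom := Hom
  id M :=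
    { functor := 𝟭 C
      isHeyting := inferInstance
      map_sort := fun _ => rfl
      map_interp := fun _ _ _ => mapCtx_id _ _ }
  comp {M N P} f g :=
    { functor := f.functor ⋙ g.functor
      isHeyting := inferInstance
      map_sort := fun s => by rw [Functor.comp_obj, f.map_sort, g.map_sort]
      map_interp := fun Γ φ h => by
        rw [mapCtx_comp f.functor g.functor f.map_sort g.map_sort, f.map_interp, g.map_interp] }

/-- The action `A ↦ h(A)` of a Σ-H-homomorphism on sub-objects in context. -/
def Hom.mapCtxSub {M N : HStructure C Sg} (h : Hom M N) (A : M.CtxSub) : N.CtxSub :=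
  ⟨A.1, mapCtx h.functor h.map_sort A.2⟩

/-- The Σ-H-structures all of whose sorts are inhabited: the image of `M s ⟶ 1` is `1`. -/
def IsInhabited (C : Type u) [Category.{v} C] [HeytingCategory C] (Sg : LogicalSignature.{w}) :
    ObjectProperty (HStructure C Sg) := fun M =>
  ∀ s, imageSubobject (terminal.from (M.sort s)) = ⊤

/-- `⟨𝔻, N⟩` is the logically distributive category `LD(M)` associated with `M`, the bijection
`e` identifying the objects of `𝔻` with the sub-objects in context `⟦FV(φ). φ⟧`. -/
structure IsAssociated (M : HStructure C Sg) (X : SigmaStr.{w, r} Sg)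
    (e : X.Obj ≃ Set.range M.interpFV) : Prop where
  map_M : ∀ φ, (e (X.M φ)).1 = M.interpFV φ
  thin : ∀ A B : X.Obj, Subsingleton (A ⟶ B)
  nonempty_hom_iff : ∀ φ ψ, Nonempty (X.M φ ⟶ X.M ψ) ↔
    M.interp (φ.FV ∪ ψ.FV) φ Finset.subset_union_left ≤
      M.interp (φ.FV ∪ ψ.FV) ψ Finset.subset_union_right

end HStructure

end Heyting

end Definitions

/-! ### Sub-objects: adjoints of pullback, Beck–Chevalley, Frobenius, covers -/

section SubobjectCalculus

variable {C : Type u} [Category.{v} C] [HeytingCategory C]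

/-! `LD(M)` is a preorder, so every equation between arrows holds and each clause of logical
distributivity reduces to the existence of some arrows, that is, to an intuitionistic rule for
`Entails`. The propositional rules come from the Heyting algebras of sub-objects, the quantifier
rules from `∃_f ⊣ f^* ⊣ ∀_f` together with the substitution lemma `LType.eval_subst`, which rests on
Beck–Chevalley and Frobenius.

A cone over all instances `A[t/x]` includes the leg at `t = x`, where `A[x/x] = A`. If its vertex is
named by `B` with `x` not free in `B`, this leg says that `B` entails `A`, hence `∀x.A`. So `∀x.A`
is terminal, and dually `∃x.A` is initial.

Inhabited sorts are needed because entailment is tested in the context `FV(φ) ∪ FV(ψ)`, while a cut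
formula or a substituted term may bring in further variables. The projection `X × Ms ⟶ X` is a
pullback of the cover `Ms ⟶ 1`, and pulling back along a cover reflects the order, so extra
variables can be discarded (`Entails.of_eval_le`).

A Σ-H-homomorphism preserves interpretations, hence entailment. Since every object is named by a
λ-type, a functor into a thin category that respects names preserves the whole structure, and two
such functors are equal; this yields the Σ-homomorphism and the functor laws. -/

theorem pullback_obj_factors_iff {X Y Z : C} (f : X ⟶ Y) (A : Subobject Y) (g : Z ⟶ X) :
    ((Subobject.pullback f).obj A).Factors g ↔ A.Factors (g ≫ f) := by
  constructor
  · intro h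
    rw [← Subobject.factorThru_arrow _ g h, Category.assoc, ← (Subobject.isPullback f A).w,
      ← Category.assoc]
    exact Subobject.factors_comp_arrow _
  · intro h
    have := (Subobject.isPullback f A).lift_snd (A.factorThru _ h) g (by simp)
    rw [← this]
    exact Subobject.factors_comp_arrow _

theorem exSub_le_iff {X Y : C} (f : X ⟶ Y) (A : Subobject X) (B : Subobject Y) :
    exSub f A ≤ B ↔ A ≤ (Subobject.pullback f).obj B := by
  have : (Subobject.pullback f).IsRightAdjoint := (Subobject.existsPullbackAdj f).isRightAdjoint
  exact ⟨fun h => (((Adjunction.ofIsRightAdjoint (Subobject.pullback f)).homEquiv A B) h.hom).le,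
    fun h => (((Adjunction.ofIsRightAdjoint (Subobject.pullback f)).homEquiv A B).symm h.hom).le⟩

theorem imageSubobject_le_iff {X Y : C} (f : X ⟶ Y) (B : Subobject Y) :
    imageSubobject f ≤ B ↔ B.Factors f :=
  ⟨fun h => Subobject.factors_of_le f h (by
      simpa using imageSubobject_factors_comp_self f (𝟙 X)),
    fun h => imageSubobject_le f (B.factorThru f h) (by simp)⟩

/-- Both sides have the same upper bounds. This turns the assumed stability of images into a
statement about `∃_f`. -/
theorem exSub_eq_imageSubobject {X Y : C} (f : X ⟶ Y) (A : Subobject X) :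
    exSub f A = imageSubobject (A.arrow ≫ f) := by
  refine eq_of_forall_ge_iff fun B => ?_
  rw [exSub_le_iff, imageSubobject_le_iff, ← pullback_obj_factors_iff]
  exact ⟨fun h => Subobject.factors_of_le _ h (Subobject.factors_self A),
    Subobject.le_of_factors⟩

theorem imageSubobject_eq_of_iso {X X' Y : C} (i : X' ≅ X) (f : X ⟶ Y) (g : X' ⟶ Y)
    (h : i.hom ≫ f = g) : imageSubobject g = imageSubobject f := by
  subst h
  exact imageSubobject_iso_comp _ _

/-- The Beck–Chevalley condition for existential quantification. -/
theorem pullback_exSub {W X Y Z : C} {g' : W ⟶ X} {f' : W ⟶ Z} {f : X ⟶ Y} {g : Z ⟶ Y}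
    (sq : IsPullback g' f' f g) (A : Subobject X) :
    (Subobject.pullback g).obj (exSub f A) = exSub f' ((Subobject.pullback g').obj A) := by
  -- Pasting the pullback of `A` onto the square exhibits the pullback of `A.arrow ≫ f` along `g`,
  -- whose image is known by stability.
  have sq' := (Subobject.isPullback g' A).paste_vert sq
  rw [exSub_eq_imageSubobject, exSub_eq_imageSubobject, HeytingCategory.image_stable]
  exact (imageSubobject_eq_of_iso sq'.isoPullback _ _ (by simp)).symm

/-- The Beck–Chevalley condition for universal quantification. -/
theorem pullback_allSub {W X Y Z : C} {g' : W ⟶ X} {f' : W ⟶ Z} {f : X ⟶ Y} {g : Z ⟶ Y}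
    (sq : IsPullback g' f' f g) (A : Subobject X) :
    (Subobject.pullback g).obj (allSub f A) = allSub f' ((Subobject.pullback g').obj A) := by
  refine eq_of_forall_le_iff fun B => ?_
  -- Transposing across the adjunctions reduces the claim to Beck–Chevalley for `∃` in the flipped
  -- square.
  rw [← exSub_le_iff, le_allSub_iff, le_allSub_iff, pullback_exSub sq.flip, exSub_le_iff]

theorem pullback_inf {X Y : C} (f : X ⟶ Y) (A B : Subobject Y) :
    (Subobject.pullback f).obj (A ⊓ B) =
      (Subobject.pullback f).obj A ⊓ (Subobject.pullback f).obj B := by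
  refine eq_of_forall_le_iff fun S => ?_
  rw [← exSub_le_iff, le_inf_iff, le_inf_iff, exSub_le_iff, exSub_le_iff]

theorem pullback_top {X Y : C} (f : X ⟶ Y) :
    (Subobject.pullback f).obj (⊤ : Subobject Y) = ⊤ :=
  Subobject.pullback_top f

theorem pullback_bot {X Y : C} (f : X ⟶ Y) :
    (Subobject.pullback f).obj (⊥ : Subobject Y) = ⊥ :=
  (HeytingCategory.bot_stable f ⊥ isBot_bot).eq_bot

theorem pullback_sup {X Y : C} (f : X ⟶ Y) (A B : Subobject Y) :
    (Subobject.pullback f).obj (A ⊔ B) =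
      (Subobject.pullback f).obj A ⊔ (Subobject.pullback f).obj B :=
  (HeytingCategory.sup_stable f A B _ isLUB_pair).unique isLUB_pair

theorem pullback_mono {X Y : C} (f : X ⟶ Y) {A B : Subobject Y} (h : A ≤ B) :
    (Subobject.pullback f).obj A ≤ (Subobject.pullback f).obj B :=
  (Subobject.pullback f).monotone h

/-- Heyting implication is by definition `∀_A A^*`, so its left adjoint `A ⊓ -` is `∃_A A^*`. -/
theorem exSub_arrow_pullback {X : C} (A B : Subobject X) :
    exSub A.arrow ((Subobject.pullback A.arrow).obj B) = A ⊓ B := by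
  refine eq_of_forall_ge_iff fun S => ?_
  rw [exSub_le_iff, ← le_himp_iff']
  have h : A ⇨ S = allSub A.arrow ((Subobject.pullback A.arrow).obj S) := rfl
  rw [h, le_allSub_iff]

/-- Frobenius reciprocity. -/
theorem exSub_inf_pullback {X Y : C} (f : X ⟶ Y) (A : Subobject X) (B : Subobject Y) :
    exSub f (A ⊓ (Subobject.pullback f).obj B) = exSub f A ⊓ B := by
  -- Meets become `∃` along monomorphisms, and Beck–Chevalley for the pullback of `B` along `f`
  -- leaves `∃` along the two composites of one commutative square.
  rw [inf_comm, ← exSub_arrow_pullback, inf_comm, ← exSub_arrow_pullback,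
    pullback_exSub (Subobject.isPullback f B).flip]
  refine eq_of_forall_ge_iff fun S => ?_
  rw [exSub_le_iff, exSub_le_iff, exSub_le_iff, exSub_le_iff, ← Subobject.pullback_comp,
    ← Subobject.pullback_comp, (Subobject.isPullback f B).w]

/-- The transpose of Frobenius reciprocity. -/
theorem pullback_himp {X Y : C} (f : X ⟶ Y) (A B : Subobject Y) :
    (Subobject.pullback f).obj (A ⇨ B) =
      (Subobject.pullback f).obj A ⇨ (Subobject.pullback f).obj B := by
  refine eq_of_forall_le_iff fun S => ?_
  rw [← exSub_le_iff, le_himp_iff, ← exSub_inf_pullback, exSub_le_iff, le_himp_iff]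

theorem pullback_allSub_fst {X Y : C} (f : X ⟶ Y) (Z : C) (A : Subobject (Y ⨯ Z)) :
    (Subobject.pullback f).obj (allSub prod.fst A) =
      allSub prod.fst ((Subobject.pullback (prod.map f (𝟙 Z))).obj A) :=
  pullback_allSub (IsPullback.of_prod_fst_with_id f Z).flip A

theorem pullback_exSub_fst {X Y : C} (f : X ⟶ Y) (Z : C) (A : Subobject (Y ⨯ Z)) :
    (Subobject.pullback f).obj (exSub prod.fst A) =
      exSub prod.fst ((Subobject.pullback (prod.map f (𝟙 Z))).obj A) :=
  pullback_exSub (IsPullback.of_prod_fst_with_id f Z).flip A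

/-- An arrow is a cover when its image is the whole codomain; pulling back along it then reflects
the order of sub-objects. -/
theorem le_of_pullback_le {X Y : C} (f : X ⟶ Y) (hf : imageSubobject f = ⊤) {A B : Subobject Y}
    (h : (Subobject.pullback f).obj A ≤ (Subobject.pullback f).obj B) : A ≤ B := by
  have hf' : exSub f ⊤ = ⊤ := by
    refine eq_of_forall_ge_iff fun S => ?_
    rw [← hf, imageSubobject_le_iff, exSub_le_iff]
    refine ⟨fun h => ?_, fun h => ?_⟩
    · simpa using (pullback_obj_factors_iff f S (𝟙 X)).1
        (Subobject.factors_of_le _ h (Subobject.top_factors _))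
    · refine Subobject.le_of_factors ?_
      rw [pullback_obj_factors_iff]
      exact Subobject.factors_of_factors_right _ h
  rw [← exSub_le_iff] at h
  -- For a cover, Frobenius gives `∃_f f^* A = A`.
  calc A = exSub f (⊤ ⊓ (Subobject.pullback f).obj A) := by
        rw [exSub_inf_pullback, hf', top_inf_eq]
    _ = exSub f ((Subobject.pullback f).obj A) := by rw [top_inf_eq]
    _ ≤ B := h

/-- The projection is the pullback of `Z ⟶ 1` along `X ⟶ 1`, and images are stable. -/
theorem imageSubobject_prod_fst (X Z : C) (hZ : imageSubobject (terminal.from Z) = ⊤) :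
    imageSubobject (prod.fst : X ⨯ Z ⟶ X) = ⊤ := by
  have sq : IsPullback (prod.snd : X ⨯ Z ⟶ Z) prod.fst (terminalIsTerminal.from Z)
      (terminalIsTerminal.from X) :=
    (IsPullback.of_isLimit_binaryFan_of_isTerminal (prodIsProd X Z) terminalIsTerminal).flip
  rw [imageSubobject_eq_of_iso sq.isoPullback (pullback.snd _ _) _ sq.isoPullback_hom_snd,
    ← HeytingCategory.image_stable, Subsingleton.elim (terminalIsTerminal.from Z) (terminal.from Z),
    hZ, pullback_top]

end SubobjectCalculus

/-! ### Interpretation of terms and formulae, and the substitution lemma -/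

section Evaluation

variable {C : Type u} [Category.{v} C] [HeytingCategory C] {Sg : LogicalSignature.{w}}
  {M : HStructure C Sg}

/-- Restriction of a valuation along an arrow. -/
def CtxVal.comp {X Y : C} {Γ : Finset (TVar Sg.Srt)} (f : Y ⟶ X) (ρ : CtxVal M X Γ) :
    CtxVal M Y Γ :=
  fun v hv => f ≫ ρ v hv

/-- Restriction of a valuation to a smaller context. -/
def CtxVal.restrict {X : C} {Γ Δ : Finset (TVar Sg.Srt)} (ρ : CtxVal M X Γ) (h : Δ ⊆ Γ) :
    CtxVal M X Δ :=
  fun v hv => ρ v (h hv)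

theorem CtxVal.extend_self {X : C} {Γ : Finset (TVar Sg.Srt)} (ρ : CtxVal M X Γ)
    (x : TVar Sg.Srt) (hx : x ∈ insert x Γ) : ρ.extend x x hx = prod.snd := by
  simp [CtxVal.extend]

theorem CtxVal.extend_of_ne {X : C} {Γ : Finset (TVar Sg.Srt)} (ρ : CtxVal M X Γ)
    {x v : TVar Sg.Srt} (hvx : v ≠ x) (hv : v ∈ insert x Γ) :
    ρ.extend x v hv = prod.fst ≫ ρ v ((Finset.mem_insert.1 hv).resolve_left hvx) := by
  simp [CtxVal.extend, hvx]

theorem CtxVal.extend_comp {X Y : C} {Γ : Finset (TVar Sg.Srt)} (f : Y ⟶ X) (ρ : CtxVal M X Γ)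
    (x : TVar Sg.Srt) :
    (ρ.comp f).extend x = (ρ.extend x).comp (prod.map f (𝟙 (M.sort x.sort))) := by
  funext v hv
  by_cases hvx : v = x
  · subst hvx
    simp only [CtxVal.comp]
    rw [extend_self, extend_self, prod.map_snd, Category.comp_id]
  · simp only [CtxVal.comp]
    rw [extend_of_ne _ hvx, extend_of_ne _ hvx, prod.map_fst_assoc]
    rfl

namespace LTerm

theorem eval_congr {X : C} {Γ Γ' : Finset (TVar Sg.Srt)} {s : Sg.Srt} (t : LTerm Sg s)
    (ρ : CtxVal M X Γ) (ρ' : CtxVal M X Γ') (h : t.FV ⊆ Γ) (h' : t.FV ⊆ Γ')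
    (hρ : ∀ v ∈ t.FV, ∀ hv hv', ρ v hv = ρ' v hv') : t.eval M ρ h = t.eval M ρ' h' := by
  induction t with
  | var v => exact hρ v (Finset.mem_singleton_self v) _ _
  | app f args ih =>
    simp only [eval]
    congr 2
    funext i
    exact ih i _ _ fun v hv =>
      hρ v (Finset.subset_biUnion_of_mem (fun i => (args i).FV) (Finset.mem_univ i) hv)

theorem eval_comp {X Y : C} {Γ : Finset (TVar Sg.Srt)} {s : Sg.Srt} (t : LTerm Sg s)
    (f : Y ⟶ X) (ρ : CtxVal M X Γ) (h : t.FV ⊆ Γ) :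
    t.eval M (ρ.comp f) h = f ≫ t.eval M ρ h := by
  induction t with
  | var v => rfl
  | app g args ih =>
    simp only [eval]
    rw [← Category.assoc]
    congr 1
    apply Pi.hom_ext
    intro i
    simp [ih]

theorem eval_subst {X : C} {Γ Δ : Finset (TVar Sg.Srt)} {s : Sg.Srt} (t : LTerm Sg s)
    (σ : LSubst Sg) (ρ : CtxVal M X Δ) (ρ' : CtxVal M X Γ) (h : (t.subst σ).FV ⊆ Δ)
    (h' : t.FV ⊆ Γ) (hρ : ∀ v ∈ t.FV, ∀ hv hσ, ρ' v hv = (σ v).eval M ρ hσ) :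
    (t.subst σ).eval M ρ h = t.eval M ρ' h' := by
  induction t with
  | var v => exact (hρ v (Finset.mem_singleton_self v) _ _).symm
  | app f args ih =>
    simp only [eval, subst]
    congr 2
    funext i
    exact ih i _ _ fun v hv =>
      hρ v (Finset.subset_biUnion_of_mem (fun i => (args i).FV) (Finset.mem_univ i) hv)

end LTerm

namespace LType

theorem eval_congr (A : LType Sg) : ∀ {X : C} {Γ Γ' : Finset (TVar Sg.Srt)}
    (ρ : CtxVal M X Γ) (ρ' : CtxVal M X Γ') (h : A.FV ⊆ Γ) (h' : A.FV ⊆ Γ'),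
    (∀ v ∈ A.FV, ∀ hv hv', ρ v hv = ρ' v hv') → A.eval M ρ h = A.eval M ρ' h' := by
  induction A with
  | zero | one => intros; rfl
  | rel r args =>
    intro X Γ Γ' ρ ρ' h h' hρ
    simp only [eval]
    congr 3
    funext i
    exact (args i).eval_congr _ _ _ _ fun v hv =>
      hρ v (Finset.subset_biUnion_of_mem (fun i => (args i).FV) (Finset.mem_univ i) hv)
  | prod A B ihA ihB | sum A B ihA ihB | arr A B ihA ihB =>
    intro X Γ Γ' ρ ρ' h h' hρ
    simp only [eval]
    rw [ihA ρ ρ' _ (Finset.union_subset_left h') fun v hv => hρ v (Finset.mem_union_left _ hv),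
      ihB ρ ρ' _ (Finset.union_subset_right h') fun v hv => hρ v (Finset.mem_union_right _ hv)]
  | all x A ih | ex x A ih =>
    intro X Γ Γ' ρ ρ' h h' hρ
    simp only [eval]
    congr 1
    refine ih _ _ _ _ fun v hv hv₁ hv₂ => ?_
    by_cases hvx : v = x
    · subst hvx
      rw [CtxVal.extend_self, CtxVal.extend_self]
    · rw [CtxVal.extend_of_ne _ hvx, CtxVal.extend_of_ne _ hvx,
        hρ v (Finset.mem_erase.2 ⟨hvx, hv⟩)]

/-- Every connective is stable under pullback. Under a binder `f` becomes `f × 1`, and its square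
with the projections is a pullback, so Beck–Chevalley applies. -/
theorem eval_comp (A : LType Sg) : ∀ {X Y : C} {Γ : Finset (TVar Sg.Srt)}
    (f : Y ⟶ X) (ρ : CtxVal M X Γ) (h : A.FV ⊆ Γ),
    A.eval M (ρ.comp f) h = (Subobject.pullback f).obj (A.eval M ρ h) := by
  induction A with
  | zero => intros; exact (pullback_bot _).symm
  | one => intros; exact (pullback_top _).symm
  | rel r args =>
    intro X Y Γ f ρ h
    simp only [eval]
    rw [← Subobject.pullback_comp]
    congr 2
    apply Pi.hom_ext
    intro i
    simp [LTerm.eval_comp]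
  | prod A B ihA ihB =>
    intro X Y Γ f ρ h
    simp only [eval]
    rw [ihA, ihB, pullback_inf]
  | sum A B ihA ihB =>
    intro X Y Γ f ρ h
    simp only [eval]
    rw [ihA, ihB, pullback_sup]
  | arr A B ihA ihB =>
    intro X Y Γ f ρ h
    simp only [eval]
    rw [ihA, ihB, pullback_himp]
  | all x A ih =>
    intro X Y Γ f ρ h
    simp only [eval]
    rw [CtxVal.extend_comp, ih, pullback_allSub_fst]
  | ex x A ih =>
    intro X Y Γ f ρ h
    simp only [eval]
    rw [CtxVal.extend_comp, ih, pullback_exSub_fst]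

/-- Either `x` was already outside `F`, or the new index exceeds every index in `F`. -/
theorem boundName_notMem (x : TVar Sg.Srt) (F : Finset (TVar Sg.Srt)) :
    (⟨x.sort, boundName x F⟩ : TVar Sg.Srt) ∉ F := by
  unfold boundName
  split_ifs with hx
  · intro h
    exact absurd (Finset.le_sup (f := TVar.idx) h) (Nat.not_succ_le_self _)
  · exact hx

/-- The binder case of the substitution lemma: the compatibility of `ρ'` with `σ` and `ρ` passes
under the quantifier, because the new variable occurs in no substituted term and extending `ρ` by it
changes none of their values. -/
theorem extend_eq_eval_update {X : C} {Γ Δ : Finset (TVar Sg.Srt)} (A : LType Sg)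
    (x : TVar Sg.Srt) (n : ℕ) (σ : LSubst Sg) (ρ : CtxVal M X Δ) (ρ' : CtxVal M X Γ)
    (hn : (⟨x.sort, n⟩ : TVar Sg.Srt) ∉ (A.FV.erase x).biUnion fun v => (σ v).FV)
    (hρ : ∀ v ∈ A.FV.erase x, ∀ hv hσ, ρ' v hv = (σ v).eval M ρ hσ) :
    ∀ v ∈ A.FV, ∀ hv hσ, ρ'.extend x v hv =
      ((Function.update σ x (LTerm.var ⟨x.sort, n⟩) : LSubst Sg) v).eval M
        (ρ.extend ⟨x.sort, n⟩) hσ := by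
  intro v hvA hv hσ
  by_cases hvx : v = x
  · subst hvx
    -- The updated substitution is replaced by a variable term equal to it, since the proof `hσ`
    -- depends on it and obstructs rewriting.
    have h : ∀ (t : LTerm Sg v.sort) (ht : t = LTerm.var ⟨v.sort, n⟩) hσ,
        ρ'.extend v v hv = t.eval M (ρ.extend ⟨v.sort, n⟩) hσ := by
      rintro _ rfl hσ
      rw [CtxVal.extend_self]
      exact (CtxVal.extend_self ρ ⟨v.sort, n⟩ _).symm
    exact h _ (Function.update_self (β := fun u : TVar Sg.Srt => LTerm Sg u.sort) _ _ _) hσ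
  · have hvA' : v ∈ A.FV.erase x := Finset.mem_erase.2 ⟨hvx, hvA⟩
    have h : ∀ (t : LTerm Sg v.sort) (ht : t = σ v) hσ,
        ρ'.extend x v hv = t.eval M (ρ.extend ⟨x.sort, n⟩) hσ := by
      rintro _ rfl hσ
      have hz : (⟨x.sort, n⟩ : TVar Sg.Srt) ∉ (σ v).FV := fun h =>
        hn (Finset.mem_biUnion.2 ⟨v, hvA', h⟩)
      have hσ' : (σ v).FV ⊆ Δ := (Finset.subset_insert_iff_of_notMem hz).1 hσ
      rw [CtxVal.extend_of_ne _ hvx, hρ v hvA' _ hσ', ← LTerm.eval_comp]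
      refine LTerm.eval_congr _ _ _ _ _ fun u hu _ hu' => ?_
      have hne : u ≠ ⟨x.sort, n⟩ := by rintro rfl; exact hz hu
      exact (CtxVal.extend_of_ne ρ hne hu').symm
    exact h _ (Function.update_of_ne hvx _ _) hσ

/-- The substitution lemma: substitution is interpreted by composition. -/
theorem eval_subst (A : LType Sg) : ∀ {X : C} {Γ Δ : Finset (TVar Sg.Srt)}
    (σ : LSubst Sg) (ρ : CtxVal M X Δ) (ρ' : CtxVal M X Γ) (h : (A.subst σ).FV ⊆ Δ)
    (h' : A.FV ⊆ Γ), (∀ v ∈ A.FV, ∀ hv hσ, ρ' v hv = (σ v).eval M ρ hσ) →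
    (A.subst σ).eval M ρ h = A.eval M ρ' h' := by
  induction A with
  | zero | one => intros; rfl
  | rel r args =>
    intro X Γ Δ σ ρ ρ' h h' hρ
    simp only [eval, subst]
    congr 3
    funext i
    exact (args i).eval_subst _ _ _ _ _ fun v hv =>
      hρ v (Finset.subset_biUnion_of_mem (fun i => (args i).FV) (Finset.mem_univ i) hv)
  | prod A B ihA ihB | sum A B ihA ihB | arr A B ihA ihB =>
    intro X Γ Δ σ ρ ρ' h h' hρ
    simp only [eval, subst]
    rw [ihA σ ρ ρ' _ (Finset.union_subset_left h') fun v hv => hρ v (Finset.mem_union_left _ hv),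
      ihB σ ρ ρ' _ (Finset.union_subset_right h') fun v hv => hρ v (Finset.mem_union_right _ hv)]
  | all x A ih | ex x A ih =>
    intro X Γ Δ σ ρ ρ' h h' hρ
    simp only [eval, subst]
    exact congrArg _ (ih _ _ _ _ _
      (extend_eq_eval_update A x _ σ ρ ρ' (boundName_notMem x _) hρ))

/-- `A[t/x]` is interpreted by the pullback along `⟨1, t⟩` of the interpretation of `A`. -/
theorem eval_inst {X : C} {Γ : Finset (TVar Sg.Srt)} (A : LType Sg) (x : TVar Sg.Srt)
    (t : LTerm Sg x.sort) (ρ : CtxVal M X Γ) (ht : t.FV ⊆ Γ) (h : (A.inst x t).FV ⊆ Γ)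
    (hA : A.FV ⊆ insert x Γ) :
    (A.inst x t).eval M ρ h =
      (Subobject.pullback (prod.lift (𝟙 X) (t.eval M ρ ht))).obj (A.eval M (ρ.extend x) hA) := by
  rw [← eval_comp]
  refine eval_subst A _ _ _ _ _ fun v _ hv hσ => ?_
  by_cases hvx : v = x
  · subst hvx
    have h : ∀ (t' : LTerm Sg v.sort) (ht' : t' = t) hσ,
        (ρ.extend v).comp (prod.lift (𝟙 X) (t.eval M ρ ht)) v hv = t'.eval M ρ hσ := by
      rintro _ rfl hσ
      simp only [CtxVal.comp]
      rw [CtxVal.extend_self, prod.lift_snd]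
    exact h _ (Function.update_self (β := fun u : TVar Sg.Srt => LTerm Sg u.sort) _ _ _) hσ
  · have h : ∀ (t' : LTerm Sg v.sort) (ht' : t' = LTerm.var v) hσ,
        (ρ.extend x).comp (prod.lift (𝟙 X) (t.eval M ρ ht)) v hv = t'.eval M ρ hσ := by
      rintro _ rfl hσ
      simp only [CtxVal.comp]
      rw [CtxVal.extend_of_ne _ hvx, prod.lift_fst_assoc, Category.id_comp]
      rfl
    exact h _ (Function.update_of_ne hvx _ _) hσ

/-- The counit `fst^* ∀A ≤ A`, pulled back along the section `⟨1, t⟩` of the projection. The next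
lemma treats the unit of `∃` in the same way. -/
theorem all_le_eval_inst {X : C} {Γ : Finset (TVar Sg.Srt)} (A : LType Sg) (x : TVar Sg.Srt)
    (t : LTerm Sg x.sort) (ρ : CtxVal M X Γ) (ht : t.FV ⊆ Γ) (h : (A.inst x t).FV ⊆ Γ)
    (hA : (all x A).FV ⊆ Γ) : (all x A).eval M ρ hA ≤ (A.inst x t).eval M ρ h := by
  rw [eval_inst A x t ρ ht h (Finset.subset_insert_iff.2 hA)]
  simp only [eval]
  have := pullback_mono (prod.lift (𝟙 X) (t.eval M ρ ht))
    ((le_allSub_iff prod.fst (A.eval M (ρ.extend x) (Finset.subset_insert_iff.2 hA)) _).1 le_rfl)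
  rwa [← Subobject.pullback_comp, prod.lift_fst, Subobject.pullback_id] at this

theorem eval_inst_le_ex {X : C} {Γ : Finset (TVar Sg.Srt)} (A : LType Sg) (x : TVar Sg.Srt)
    (t : LTerm Sg x.sort) (ρ : CtxVal M X Γ) (ht : t.FV ⊆ Γ) (h : (A.inst x t).FV ⊆ Γ)
    (hA : (ex x A).FV ⊆ Γ) : (A.inst x t).eval M ρ h ≤ (ex x A).eval M ρ hA := by
  rw [eval_inst A x t ρ ht h (Finset.subset_insert_iff.2 hA)]
  simp only [eval]
  have := pullback_mono (prod.lift (𝟙 X) (t.eval M ρ ht))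
    ((exSub_le_iff prod.fst (A.eval M (ρ.extend x) (Finset.subset_insert_iff.2 hA)) _).1 le_rfl)
  rwa [← Subobject.pullback_comp (g := prod.fst), prod.lift_fst, Subobject.pullback_id] at this

theorem eval_extend {X : C} {Γ : Finset (TVar Sg.Srt)} (A : LType Sg) (x : TVar Sg.Srt)
    (hx : x ∉ A.FV) (ρ : CtxVal M X Γ) (h : A.FV ⊆ Γ) (h' : A.FV ⊆ insert x Γ) :
    A.eval M (ρ.extend x) h' = (Subobject.pullback prod.fst).obj (A.eval M ρ h) := by
  rw [← eval_comp]
  refine eval_congr A _ _ _ _ fun v hv hv₁ _ => ?_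
  exact CtxVal.extend_of_ne ρ (by rintro rfl; exact hx hv) hv₁

end LType

/-- When sorts are inhabited, a valuation can be extended to a larger context along a cover. -/
theorem CtxVal.exists_extension (hM : HStructure.IsInhabited C Sg M) {X : C}
    {Γ : Finset (TVar Sg.Srt)} (ρ : CtxVal M X Γ) (Δ : Finset (TVar Sg.Srt)) :
    ∃ (Y : C) (f : Y ⟶ X) (ρ' : CtxVal M Y (Γ ∪ Δ)),
      (∀ A B : Subobject X, (Subobject.pullback f).obj A ≤ (Subobject.pullback f).obj B → A ≤ B) ∧
      ∀ v hv hv', ρ' v hv' = f ≫ ρ v hv := by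
  induction Δ using Finset.induction_on with
  | empty =>
    refine ⟨X, 𝟙 X, ρ.restrict (by simp), fun A B h => ?_, fun v hv hv' => ?_⟩
    · simpa only [Subobject.pullback_id] using h
    · simp [CtxVal.restrict]
  | insert x Δ hx ih =>
    obtain ⟨Y, f, ρ', hf, hρ'⟩ := ih
    -- A variable of `Γ` must keep its value, which `extend` would overwrite; only a variable
    -- outside `Γ` costs a new factor.
    by_cases hxΓ : x ∈ Γ
    · refine ⟨Y, f, ρ'.restrict ?_, hf, fun v hv hv' => hρ' v hv _⟩
      intro v hv
      rcases Finset.mem_union.1 hv with h | h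
      · exact Finset.mem_union_left _ h
      · rcases Finset.mem_insert.1 h with rfl | h
        · exact Finset.mem_union_left _ hxΓ
        · exact Finset.mem_union_right _ h
    · refine ⟨Y ⨯ M.sort x.sort, prod.fst ≫ f,
        (ρ'.extend x).restrict (by rw [Finset.union_insert]), fun A B h => hf A B ?_,
        fun v hv hv' => ?_⟩
      · rw [Subobject.pullback_comp, Subobject.pullback_comp] at h
        exact le_of_pullback_le _ (imageSubobject_prod_fst _ _ (hM x.sort)) h
      · have hvx : v ≠ x := by rintro rfl; exact hxΓ hv
        simp only [CtxVal.restrict]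
        rw [CtxVal.extend_of_ne _ hvx, hρ' v hv, Category.assoc]

/-! ### Entailment and the rules of intuitionistic logic -/

namespace HStructure

/-- The projections form the generic valuation; any other is its restriction along a tuple. -/
theorem eval_eq_pullback_interp {X : C} {Γ Δ : Finset (TVar Sg.Srt)} (A : LType Sg)
    (ρ : CtxVal M X Γ) (h : A.FV ⊆ Γ) (hΔ : Δ ⊆ Γ) (h' : A.FV ⊆ Δ) :
    A.eval M ρ h = (Subobject.pullback (Pi.lift fun v : {v // v ∈ Δ} => ρ v.1 (hΔ v.2))).obj
      (M.interp Δ A h') := by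
  rw [interp, ← LType.eval_comp]
  refine LType.eval_congr A _ _ _ _ fun v _ hv hv' => ?_
  exact (Pi.lift_π (fun v : {v // v ∈ Δ} => ρ v.1 (hΔ v.2)) ⟨v, hv'⟩).symm

variable (M) in
/-- The order between formulae: `⟦FV(φ) ∪ FV(ψ). φ⟧ ≤ ⟦FV(φ) ∪ FV(ψ). ψ⟧`. -/
def Entails (φ ψ : LType Sg) : Prop :=
  M.interp (φ.FV ∪ ψ.FV) φ Finset.subset_union_left ≤
    M.interp (φ.FV ∪ ψ.FV) ψ Finset.subset_union_right

theorem Entails.eval_le {φ ψ : LType Sg} (h : M.Entails φ ψ) {X : C} {Γ : Finset (TVar Sg.Srt)}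
    (ρ : CtxVal M X Γ) (hφ : φ.FV ⊆ Γ) (hψ : ψ.FV ⊆ Γ) : φ.eval M ρ hφ ≤ ψ.eval M ρ hψ := by
  rw [eval_eq_pullback_interp φ ρ hφ (Finset.union_subset hφ hψ) Finset.subset_union_left,
    eval_eq_pullback_interp ψ ρ hψ (Finset.union_subset hφ hψ) Finset.subset_union_right]
  exact pullback_mono _ h

/-- When sorts are inhabited, entailment may be checked in any larger context. -/
theorem Entails.of_eval_le (hM : IsInhabited C Sg M) {φ ψ : LType Sg}
    (Δ : Finset (TVar Sg.Srt))
    (h : ∀ {X : C} {Γ : Finset (TVar Sg.Srt)} (ρ : CtxVal M X Γ) (hφ : φ.FV ⊆ Γ)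
      (hψ : ψ.FV ⊆ Γ), Δ ⊆ Γ → φ.eval M ρ hφ ≤ ψ.eval M ρ hψ) : M.Entails φ ψ := by
  obtain ⟨Y, f, ρ', hf, hρ'⟩ := CtxVal.exists_extension hM
    (fun v hv => M.ctxProj (φ.FV ∪ ψ.FV) ⟨v, hv⟩) Δ
  -- Pulling back along `f` reflects the order, and the pullbacks are the evaluations at the
  -- extended valuation.
  refine hf _ _ ?_
  have key : ∀ (A : LType Sg) (hA : A.FV ⊆ φ.FV ∪ ψ.FV) (hA' : A.FV ⊆ φ.FV ∪ ψ.FV ∪ Δ),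
      (Subobject.pullback f).obj (M.interp _ A hA) = A.eval M ρ' hA' := fun A hA hA' => by
    rw [interp, ← LType.eval_comp]
    exact LType.eval_congr A _ _ _ _ fun v _ hv hv' => (hρ' v hv hv').symm
  rw [key φ _ (Finset.subset_union_left.trans Finset.subset_union_left),
    key ψ _ (Finset.subset_union_right.trans Finset.subset_union_left)]
  exact h ρ' _ _ Finset.subset_union_right

theorem eval_eq_of_interpFV_eq {φ ψ : LType Sg} (h : M.interpFV φ = M.interpFV ψ) {X : C}
    {Γ : Finset (TVar Sg.Srt)} (ρ : CtxVal M X Γ) (hφ : φ.FV ⊆ Γ) (hψ : ψ.FV ⊆ Γ) :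
    φ.eval M ρ hφ = ψ.eval M ρ hψ := by
  -- Stated for arbitrary sub-objects in context, so that the equality can be eliminated although
  -- the type of the second component depends on the first.
  have key : ∀ c d : M.CtxSub, c = d → ∀ (hc : c.1 ⊆ Γ) (hd : d.1 ⊆ Γ),
      (Subobject.pullback (Pi.lift fun v : {v // v ∈ c.1} => ρ v.1 (hc v.2))).obj c.2 =
      (Subobject.pullback (Pi.lift fun v : {v // v ∈ d.1} => ρ v.1 (hd v.2))).obj d.2 := by
    rintro c _ rfl _ _
    rfl
  rw [eval_eq_pullback_interp φ ρ hφ hφ (Finset.Subset.refl _),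
    eval_eq_pullback_interp ψ ρ hψ hψ (Finset.Subset.refl _)]
  exact key _ _ h hφ hψ

theorem Entails.of_interpFV_eq {φ ψ : LType Sg} (h : M.interpFV φ = M.interpFV ψ) :
    M.Entails φ ψ :=
  (eval_eq_of_interpFV_eq h _ _ _).le

theorem Entails.refl (φ : LType Sg) : M.Entails φ φ :=
  of_interpFV_eq rfl

/-- The variables of the middle formula may be free in neither end, so the comparison is made in a
context containing them. -/
theorem Entails.trans (hM : IsInhabited C Sg M) {φ ψ χ : LType Sg} (h₁ : M.Entails φ ψ)
    (h₂ : M.Entails ψ χ) : M.Entails φ χ :=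
  of_eval_le hM ψ.FV fun ρ _ _ hψ => (h₁.eval_le ρ _ hψ).trans (h₂.eval_le ρ hψ _)

theorem entails_one (φ : LType Sg) : M.Entails φ .one :=
  le_top (α := Subobject _)

theorem zero_entails (φ : LType Sg) : M.Entails .zero φ :=
  bot_le (α := Subobject _)

theorem prod_entails_left (hM : IsInhabited C Sg M) (φ ψ : LType Sg) :
    M.Entails (.prod φ ψ) φ :=
  .of_eval_le hM ∅ fun _ _ _ _ => inf_le_left

theorem prod_entails_right (hM : IsInhabited C Sg M) (φ ψ : LType Sg) :
    M.Entails (.prod φ ψ) ψ :=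
  .of_eval_le hM ∅ fun _ _ _ _ => inf_le_right

theorem Entails.prod (hM : IsInhabited C Sg M) {φ ψ χ : LType Sg} (h₁ : M.Entails χ φ)
    (h₂ : M.Entails χ ψ) : M.Entails χ (.prod φ ψ) :=
  .of_eval_le hM ∅ fun ρ hχ h _ => le_inf (h₁.eval_le ρ hχ (Finset.union_subset_left h))
    (h₂.eval_le ρ hχ (Finset.union_subset_right h))

theorem left_entails_sum (hM : IsInhabited C Sg M) (φ ψ : LType Sg) :
    M.Entails φ (.sum φ ψ) :=
  .of_eval_le hM ∅ fun _ _ _ _ => le_sup_left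

theorem right_entails_sum (hM : IsInhabited C Sg M) (φ ψ : LType Sg) :
    M.Entails ψ (.sum φ ψ) :=
  .of_eval_le hM ∅ fun _ _ _ _ => le_sup_right

theorem Entails.sum (hM : IsInhabited C Sg M) {φ ψ χ : LType Sg} (h₁ : M.Entails φ χ)
    (h₂ : M.Entails ψ χ) : M.Entails (.sum φ ψ) χ :=
  .of_eval_le hM ∅ fun ρ h hχ _ => sup_le (h₁.eval_le ρ (Finset.union_subset_left h) hχ)
    (h₂.eval_le ρ (Finset.union_subset_right h) hχ)

theorem entails_arr_iff (hM : IsInhabited C Sg M) {φ ψ χ : LType Sg} :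
    M.Entails χ (.arr φ ψ) ↔ M.Entails (.prod φ χ) ψ := by
  constructor
  · intro h
    refine .of_eval_le hM φ.FV fun {X Γ} ρ h₁ hψ _ => ?_
    have := h.eval_le ρ (Finset.union_subset_right h₁)
      (Finset.union_subset (Finset.union_subset_left h₁) hψ)
    simp only [LType.eval] at this ⊢
    rwa [inf_comm, ← le_himp_iff]
  · intro h
    refine .of_eval_le hM ∅ fun {X Γ} ρ hχ h₁ _ => ?_
    have := h.eval_le ρ (Finset.union_subset (Finset.union_subset_left h₁) hχ)
      (Finset.union_subset_right h₁)
    simp only [LType.eval] at this ⊢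
    rwa [inf_comm, ← le_himp_iff] at this

/-- When the quantifier is vacuous, the variables of `t` may be absent from both formulae; they are
added to the context. -/
theorem all_entails_inst (hM : IsInhabited C Sg M) (A : LType Sg) (x : TVar Sg.Srt)
    (t : LTerm Sg x.sort) : M.Entails (.all x A) (A.inst x t) :=
  .of_eval_le hM t.FV fun ρ h₁ h₂ ht => A.all_le_eval_inst x t ρ ht h₂ h₁

theorem inst_entails_ex (hM : IsInhabited C Sg M) (A : LType Sg) (x : TVar Sg.Srt)
    (t : LTerm Sg x.sort) : M.Entails (A.inst x t) (.ex x A) :=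
  .of_eval_le hM t.FV fun ρ h₁ h₂ ht => A.eval_inst_le_ex x t ρ ht h₁ h₂

/-- As `x` is not free in `B`, the value of `B` in the extended context is `fst^*` of its value, and
the adjunction applies. -/
theorem Entails.all (hM : IsInhabited C Sg M) {A B : LType Sg} {x : TVar Sg.Srt}
    (hx : x ∉ B.FV) (h : M.Entails B A) : M.Entails B (.all x A) :=
  .of_eval_le hM ∅ fun ρ hB hA _ => (le_allSub_iff _ _ _).2 <| by
    rw [← B.eval_extend x hx ρ hB (hB.trans (Finset.subset_insert _ _))]
    exact h.eval_le _ _ _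

theorem Entails.ex (hM : IsInhabited C Sg M) {A B : LType Sg} {x : TVar Sg.Srt}
    (hx : x ∉ B.FV) (h : M.Entails A B) : M.Entails (.ex x A) B :=
  .of_eval_le hM ∅ fun ρ hA hB _ => (exSub_le_iff _ _ _).2 <| by
    rw [← B.eval_extend x hx ρ hB (hB.trans (Finset.subset_insert _ _))]
    exact h.eval_le _ _ _

end HStructure

end Evaluation

namespace HStructure

variable {C : Type u} [Category.{v} C] [HeytingCategory C] {Sg : LogicalSignature.{w}}
  {M : HStructure C Sg}

theorem Entails.prod_sum (hM : IsInhabited C Sg M) (φ ψ χ : LType Sg) :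
    M.Entails (.prod φ (.sum ψ χ)) (.sum (.prod φ ψ) (.prod φ χ)) :=
  .of_eval_le hM ∅ fun _ _ _ _ => (inf_sup_left _ _ _).le

/-- This extracts `A` itself from a cone or co-cone over all its instances. -/
theorem inst_var (A : LType Sg) (x : TVar Sg.Srt) : A.inst x (.var x) = A :=
  A.subst_eq_self _ fun v _ => by
    by_cases hvx : v = x
    · subst hvx
      exact Function.update_self (β := fun u : TVar Sg.Srt => LTerm Sg u.sort) _ _ _
    · exact Function.update_of_ne hvx _ _

/-- Implication is right adjoint to `A × -`, so it suffices that `B` entails `A → ∃x.(A × B)`, in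
which `x` is not free. -/
theorem Entails.prod_ex (hM : IsInhabited C Sg M) {x : TVar Sg.Srt} {A : LType Sg}
    (B : LType Sg) (hx : x ∉ A.FV) :
    M.Entails (.prod A (.ex x B)) (.ex x (.prod A B)) := by
  rw [← entails_arr_iff hM]
  refine .ex hM (by simp [LType.FV, hx]) ?_
  rw [entails_arr_iff hM]
  simpa only [inst_var] using inst_entails_ex hM (.prod A B) x (.var x)

end HStructure

/-! ### Logical distributivity of preorder categories -/

section Thin

variable {D : Type u₁} [Category.{v₁} D] [Quiver.IsThin D]

theorem isIso_of_isThin {X Y : D} (f : X ⟶ Y) (g : Y ⟶ X) : IsIso f :=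
  ⟨g, Subsingleton.elim _ _, Subsingleton.elim _ _⟩

theorem isLimit_binaryFan_of_isThin {X Y P : D} (p : P ⟶ X) (q : P ⟶ Y)
    (h : ∀ Z : D, (Z ⟶ X) → (Z ⟶ Y) → Nonempty (Z ⟶ P)) :
    Nonempty (IsLimit (BinaryFan.mk p q)) :=
  ⟨BinaryFan.isLimitMk (fun s => (h s.pt s.fst s.snd).some) (fun _ => Subsingleton.elim _ _)
    (fun _ => Subsingleton.elim _ _) (fun _ _ _ _ => Subsingleton.elim _ _)⟩

theorem isColimit_binaryCofan_of_isThin {X Y P : D} (p : X ⟶ P) (q : Y ⟶ P)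
    (h : ∀ Z : D, (X ⟶ Z) → (Y ⟶ Z) → Nonempty (P ⟶ Z)) :
    Nonempty (IsColimit (BinaryCofan.mk p q)) :=
  ⟨BinaryCofan.isColimitMk (fun s => (h s.pt s.inl s.inr).some) (fun _ => Subsingleton.elim _ _)
    (fun _ => Subsingleton.elim _ _) (fun _ _ _ _ => Subsingleton.elim _ _)⟩

theorem isExponential_of_isThin {A B E P : D} (p : P ⟶ A) (q : P ⟶ E) (ev : P ⟶ B)
    (hP : Nonempty (IsLimit (BinaryFan.mk p q)))
    (h : ∀ (X Q : D) (a : Q ⟶ A) (x : Q ⟶ X), Nonempty (IsLimit (BinaryFan.mk a x)) →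
      (Q ⟶ B) → Nonempty (X ⟶ E)) : IsExponential p q ev where
  isProduct := hP
  existsUnique X Q a x hQ f := by
    obtain ⟨g⟩ := h X Q a x hQ f
    exact ⟨g, fun _ _ _ => Subsingleton.elim _ _, fun _ _ => Subsingleton.elim _ _⟩

variable {Sg : LogicalSignature.{w}} {K : LType Sg → D}

/-- Commutation and uniqueness are automatic; the vertex condition `hc` provides the `star` clause
for every arrow into `c`. -/
theorem isTerminal_forallObj_of_isThin {x : TVar Sg.Srt} {A : LType Sg} (c : ForallObj K x A)
    (hc : c.pt = K (.all x A)) (h : ∀ c' : ForallObj K x A, Nonempty (c'.pt ⟶ c.pt)) :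
    Nonempty (IsTerminal c) :=
  ⟨IsTerminal.ofUniqueHom
    (fun c' => (⟨(h c').some, fun _ => Subsingleton.elim _ _, .inr hc⟩ : ForallHom c' c))
    (fun _ _ => ForallHom.ext (Subsingleton.elim _ _))⟩

theorem isInitial_existsObj_of_isThin {x : TVar Sg.Srt} {A : LType Sg} (c : ExistsObj K x A)
    (hc : c.pt = K (.ex x A)) (h : ∀ c' : ExistsObj K x A, Nonempty (c.pt ⟶ c'.pt)) :
    Nonempty (IsInitial c) :=
  ⟨IsInitial.ofUniqueHom
    (fun c' => (⟨(h c').some, fun _ => Subsingleton.elim _ _, .inr hc⟩ : ExistsHom c c'))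
    (fun _ _ => ExistsHom.ext (Subsingleton.elim _ _))⟩

variable {C : Type u} [Category.{v} C] [HeytingCategory C] {M : HStructure C Sg}

open HStructure in
/-- A preorder category whose order is entailment in a structure with inhabited sorts is
logically distributive. -/
theorem isLogicallyDistributive_of_entails (hM : HStructure.IsInhabited C Sg M)
    (hK : Function.Surjective K)
    (hom_iff : ∀ φ ψ, Nonempty (K φ ⟶ K ψ) ↔ M.Entails φ ψ) : IsLogicallyDistributive K := by
  have hom : ∀ {φ ψ}, M.Entails φ ψ → Nonempty (K φ ⟶ K ψ) := fun h => (hom_iff _ _).2 h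
  have ent : ∀ {φ ψ}, (K φ ⟶ K ψ) → M.Entails φ ψ := fun h => (hom_iff _ _).1 ⟨h⟩
  have fst : ∀ A B, K (.prod A B) ⟶ K A := fun A B => (hom (prod_entails_left hM A B)).some
  have snd : ∀ A B, K (.prod A B) ⟶ K B := fun A B => (hom (prod_entails_right hM A B)).some
  have inl : ∀ A B, K A ⟶ K (.sum A B) := fun A B => (hom (left_entails_sum hM A B)).some
  have inr : ∀ A B, K B ⟶ K (.sum A B) := fun A B => (hom (right_entails_sum hM A B)).some
  have ev : ∀ A B, K (.prod A (.arr A B)) ⟶ K B := fun A B =>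
    (hom ((entails_arr_iff hM).1 (.refl _))).some
  have prodLim : ∀ A B, Nonempty (IsLimit (BinaryFan.mk (fst A B) (snd A B))) := fun A B =>
    isLimit_binaryFan_of_isThin _ _ fun Z f g => by
      obtain ⟨χ, rfl⟩ := hK Z
      exact hom (.prod hM (ent f) (ent g))
  have sumColim : ∀ A B, Nonempty (IsColimit (BinaryCofan.mk (inl A B) (inr A B))) := fun A B =>
    isColimit_binaryCofan_of_isThin _ _ fun Z f g => by
      obtain ⟨χ, rfl⟩ := hK Z
      exact hom (.sum hM (ent f) (ent g))
  have one : Nonempty (IsTerminal (K .one)) := ⟨IsTerminal.ofUniqueHom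
    (fun X => (show Nonempty (X ⟶ K .one) by
      obtain ⟨χ, rfl⟩ := hK X
      exact hom (entails_one χ)).some) (fun _ _ => Subsingleton.elim _ _)⟩
  have zero : Nonempty (IsInitial (K .zero)) := ⟨IsInitial.ofUniqueHom
    (fun X => (show Nonempty (K .zero ⟶ X) by
      obtain ⟨χ, rfl⟩ := hK X
      exact hom (zero_entails χ)).some) (fun _ _ => Subsingleton.elim _ _)⟩
  have arr : ∀ A B, IsExponential (fst A (.arr A B)) (snd A (.arr A B)) (ev A B) := fun A B =>
    isExponential_of_isThin _ _ _ (prodLim _ _) fun X Q a x hQ f => by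
      obtain ⟨χ, rfl⟩ := hK X
      exact hom ((entails_arr_iff hM).2
        -- An arbitrary product `Q` receives an arrow from the named product `K (A × χ)`, so `f`
        -- gives an entailment.
        (ent (BinaryFan.IsLimit.lift hQ.some (fst A χ) (snd A χ) ≫ f)))
  have : HasTerminal D := one.some.hasTerminal
  have : HasInitial D := zero.some.hasInitial
  have : HasBinaryProducts D := by
    have : ∀ X Y : D, HasLimit (pair X Y) := fun X Y => by
      obtain ⟨A, rfl⟩ := hK X
      obtain ⟨B, rfl⟩ := hK Y
      exact ⟨⟨_, (prodLim A B).some⟩⟩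
    exact hasBinaryProducts_of_hasLimit_pair D
  have : HasBinaryCoproducts D := by
    have : ∀ X Y : D, HasColimit (pair X Y) := fun X Y => by
      obtain ⟨A, rfl⟩ := hK X
      obtain ⟨B, rfl⟩ := hK Y
      exact ⟨⟨_, (sumColim A B).some⟩⟩
    exact hasBinaryCoproducts_of_hasColimit_pair D
  have hp : HasFiniteProducts D := hasFiniteProducts_of_has_binary_and_terminal
  have hc : HasFiniteCoproducts D := hasFiniteCoproducts_of_has_binary_and_initial
  let all : ∀ x A, ForallObj K x A := fun x A =>
    ⟨K (.all x A), ⟨.all x A, by simp [LType.FV], rfl⟩,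
      fun t => (hom (all_entails_inst hM A x t)).some⟩
  let ex : ∀ x A, ExistsObj K x A := fun x A =>
    ⟨K (.ex x A), ⟨.ex x A, by simp [LType.FV], rfl⟩,
      fun t => (hom (inst_entails_ex hM A x t)).some⟩
  have allTerminal : ∀ x A, Nonempty (IsTerminal (all x A)) := fun x A =>
    isTerminal_forallObj_of_isThin _ rfl fun c => by
      obtain ⟨B, hB, h⟩ := c.form
      have h' := ent (eqToHom h ≫ c.leg (.var x))
      rw [inst_var] at h'
      obtain ⟨g⟩ := hom (h'.all hM hB)
      exact ⟨eqToHom h.symm ≫ g⟩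
  have exInitial : ∀ x A, Nonempty (IsInitial (ex x A)) := fun x A =>
    isInitial_existsObj_of_isThin _ rfl fun c => by
      obtain ⟨B, hB, h⟩ := c.form
      have h' := ent (c.leg (.var x) ≫ eqToHom h.symm)
      rw [inst_var] at h'
      obtain ⟨g⟩ := hom (h'.ex hM hB)
      exact ⟨g ≫ eqToHom h⟩
  exact ⟨{
    hasFiniteProducts := hp
    hasFiniteCoproducts := hc
    hasExponentials := fun X Y => by
      obtain ⟨A, rfl⟩ := hK X
      obtain ⟨B, rfl⟩ := hK Y
      exact ⟨_, _, _, _, _, arr A B⟩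
    distributive := fun X Y Z => by
      obtain ⟨A, rfl⟩ := hK X
      obtain ⟨B, rfl⟩ := hK Y
      obtain ⟨B', rfl⟩ := hK Z
      -- Any arrow back is an inverse. It passes through the named products and sums, where
      -- entailment is available.
      refine isIso_of_isThin _ ?_
      refine BinaryFan.IsLimit.lift (prodLim A (.sum B B')).some prod.fst
        (prod.snd ≫ coprod.desc (inl B B') (inr B B')) ≫ (hom (.prod_sum hM A B B')).some ≫ ?_
      exact BinaryCofan.IsColimit.desc (sumColim (.prod A B) (.prod A B')).some
        (prod.lift (fst A B) (snd A B) ≫ coprod.inl) (prod.lift (fst A B') (snd A B') ≫ coprod.inr)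
    zero := zero.some
    one := one.some
    fst := fst
    snd := snd
    prod := fun A B => (prodLim A B).some
    inl := inl
    inr := inr
    sum := fun A B => (sumColim A B).some
    ev := ev
    arr := arr
    all := all
    all_pt := fun _ _ => rfl
    all_isTerminal := fun x A => (allTerminal x A).some
    ex := ex
    ex_pt := fun _ _ => rfl
    ex_isInitial := fun x A => (exInitial x A).some
    ex_distrib := fun x A B hx Y hY _ =>
      isIso_of_isThin _ (eqToHom hY ≫ (hom (.prod_ex hM B hx)).some) }⟩

end Thin

/-! ### Functors into preorder categories that respect names -/

section ThinFunctor

variable {Sg : LogicalSignature.{w}} {X Y : SigmaStr.{w, r} Sg}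

namespace SigmaStr

/-- The `star` clause of the arrow from the given terminal cone forces `c` to have vertex `X.M
(∀x.A)`; its image then has vertex `Y.M (∀x.A)`, to which every cone maps. -/
theorem mapForall_isTerminal [Quiver.IsThin Y.Obj] (F : X.Obj ⥤ Y.Obj)
    (hF : ∀ A, F.obj (X.M A) = Y.M A) (x : TVar Sg.Srt) (A : LType Sg) (c : ForallObj X.M x A)
    (hc : Nonempty (IsTerminal c)) : Nonempty (IsTerminal (mapForall F hF c)) := by
  obtain ⟨S⟩ := X.isLogicallyDistributive
  obtain ⟨T⟩ := Y.isLogicallyDistributive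
  have hpt : c.pt = X.M (.all x A) := by
    rcases (hc.some.from (S.all x A)).star with ⟨h, -⟩ | h
    · rw [← h, S.all_pt]
    · exact h
  have hpt' : (mapForall F hF c).pt = Y.M (.all x A) :=
    (congrArg F.obj hpt).trans (hF _)
  refine isTerminal_forallObj_of_isThin _ hpt' fun c' => ?_
  exact ⟨((T.all_isTerminal x A).from c').hom ≫ eqToHom ((T.all_pt x A).trans hpt'.symm)⟩

theorem mapExists_isInitial [Quiver.IsThin Y.Obj] (F : X.Obj ⥤ Y.Obj)
    (hF : ∀ A, F.obj (X.M A) = Y.M A) (x : TVar Sg.Srt) (A : LType Sg) (c : ExistsObj X.M x A)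
    (hc : Nonempty (IsInitial c)) : Nonempty (IsInitial (mapExists F hF c)) := by
  obtain ⟨S⟩ := X.isLogicallyDistributive
  obtain ⟨T⟩ := Y.isLogicallyDistributive
  have hpt : c.pt = X.M (.ex x A) := by
    rcases (hc.some.to (S.ex x A)).star with ⟨h, -⟩ | h
    · rw [h, S.ex_pt]
    · exact h
  have hpt' : (mapExists F hF c).pt = Y.M (.ex x A) :=
    (congrArg F.obj hpt).trans (hF _)
  refine isInitial_existsObj_of_isThin _ hpt' fun c' => ?_
  exact ⟨eqToHom (hpt'.trans (T.ex_pt x A).symm) ≫ ((T.ex_isInitial x A).to c').hom⟩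

theorem preservesFiniteProducts_of_isThin [Quiver.IsThin Y.Obj] (F : X.Obj ⥤ Y.Obj)
    (hF : ∀ A, F.obj (X.M A) = Y.M A) : PreservesFiniteProducts F := by
  obtain ⟨S⟩ := X.isLogicallyDistributive
  obtain ⟨T⟩ := Y.isLogicallyDistributive
  have := S.hasFiniteProducts
  have := T.hasFiniteProducts
  have : IsIso (terminal.from (F.obj (⊤_ X.Obj))) := isIso_of_isThin _
    (T.one.from _ ≫ eqToHom (hF _).symm ≫ F.map (terminal.from _))
  have : PreservesLimit (Functor.empty.{0} X.Obj) F := preservesTerminal_of_isIso F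
    (terminal.from (F.obj (⊤_ X.Obj)))
  have : PreservesLimitsOfShape (Discrete PEmpty.{1}) F :=
    preservesLimitsOfShape_pempty_of_preservesTerminal F
  have : ∀ A B : X.Obj, IsIso (prodComparison F A B) := fun A B => by
    obtain ⟨φ, rfl⟩ := X.surjective A
    obtain ⟨ψ, rfl⟩ := X.surjective B
    -- The inverse goes through `φ × ψ`, which is a product in both categories and whose name `F`
    -- respects.
    exact isIso_of_isThin _ (BinaryFan.IsLimit.lift (T.prod φ ψ)
      (prod.fst ≫ eqToHom (hF φ)) (prod.snd ≫ eqToHom (hF ψ)) ≫ eqToHom (hF _).symm ≫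
      F.map (prod.lift (S.fst φ ψ) (S.snd φ ψ)))
  have : PreservesLimitsOfShape (Discrete WalkingPair) F :=
    ⟨fun {K} => by
      have : PreservesLimit (pair (K.obj ⟨.left⟩) (K.obj ⟨.right⟩)) F :=
        PreservesLimitPair.of_iso_prod_comparison F _ _
      exact preservesLimit_of_iso_diagram F (diagramIsoPair K).symm⟩
  exact PreservesFiniteProducts.of_preserves_binary_and_terminal F

theorem preservesFiniteCoproducts_of_isThin [Quiver.IsThin Y.Obj] (F : X.Obj ⥤ Y.Obj)
    (hF : ∀ A, F.obj (X.M A) = Y.M A) : PreservesFiniteCoproducts F := by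
  obtain ⟨S⟩ := X.isLogicallyDistributive
  obtain ⟨T⟩ := Y.isLogicallyDistributive
  have := S.hasFiniteCoproducts
  have := T.hasFiniteCoproducts
  have : IsIso (initial.to (F.obj (⊥_ X.Obj))) := isIso_of_isThin _
    (F.map (initial.to _) ≫ eqToHom (hF _) ≫ T.zero.to _)
  have : PreservesColimit (Functor.empty.{0} X.Obj) F := preservesInitial_of_isIso F
    (initial.to (F.obj (⊥_ X.Obj)))
  have : PreservesColimitsOfShape (Discrete PEmpty.{1}) F :=
    preservesColimitsOfShape_pempty_of_preservesInitial F
  have : ∀ A B : X.Obj, IsIso (coprodComparison F A B) := fun A B => by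
    obtain ⟨φ, rfl⟩ := X.surjective A
    obtain ⟨ψ, rfl⟩ := X.surjective B
    exact isIso_of_isThin _ (F.map (coprod.desc (S.inl φ ψ) (S.inr φ ψ)) ≫ eqToHom (hF _) ≫
      BinaryCofan.IsColimit.desc (T.sum φ ψ) (eqToHom (hF φ).symm ≫ coprod.inl)
        (eqToHom (hF ψ).symm ≫ coprod.inr))
  have : PreservesColimitsOfShape (Discrete WalkingPair) F :=
    ⟨fun {K} => by
      have : PreservesColimit (pair (K.obj ⟨.left⟩) (K.obj ⟨.right⟩)) F :=
        PreservesColimitPair.of_iso_coprod_comparison F _ _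
      exact preservesColimit_of_iso_diagram F (diagramIsoPair K).symm⟩
  exact ⟨fun n => PreservesFiniteCoproducts.of_preserves_binary_and_initial F (Fin n)⟩

theorem map_isExponential_of_isThin [Quiver.IsThin Y.Obj] (F : X.Obj ⥤ Y.Obj)
    (hF : ∀ A, F.obj (X.M A) = Y.M A) {A B E P : X.Obj} (p : P ⟶ A) (q : P ⟶ E) (ev : P ⟶ B)
    (h : IsExponential p q ev) : IsExponential (F.map p) (F.map q) (F.map ev) := by
  obtain ⟨S⟩ := X.isLogicallyDistributive
  obtain ⟨T⟩ := Y.isLogicallyDistributive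
  have := preservesFiniteProducts_of_isThin F hF
  refine isExponential_of_isThin _ _ _ ⟨mapIsLimitOfPreservesOfIsLimit F p q h.isProduct.some⟩
    fun Z Q a z hQ f => ?_
  obtain ⟨φ, rfl⟩ := X.surjective A
  obtain ⟨ψ, rfl⟩ := X.surjective B
  -- The arrow `g` goes from the named exponential to `E`. Below, `k` maps `Z` to the named
  -- exponential of `Y`, and following it by `F.map g` reaches `F.obj E`.
  obtain ⟨g, -⟩ := (h.existsUnique _ _ _ _ ⟨S.prod φ (.arr φ ψ)⟩ (S.ev φ ψ)).exists
  have hQ' : IsLimit (BinaryFan.mk (a ≫ eqToHom (hF φ)) z) :=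
    (isLimit_binaryFan_of_isThin _ _ fun _ f₁ f₂ =>
      ⟨BinaryFan.IsLimit.lift hQ.some (f₁ ≫ eqToHom (hF φ).symm) f₂⟩).some
  obtain ⟨k, -⟩ := ((T.arr φ ψ).existsUnique Z Q _ z ⟨hQ'⟩ (f ≫ eqToHom (hF ψ))).exists
  exact ⟨k ≫ eqToHom (hF _).symm ≫ F.map g⟩

/-- A functor between preorder categories which commutes with the interpretations of the λ-types
is a Σ-homomorphism. -/
def homOfIsThin [Quiver.IsThin Y.Obj] (F : X.Obj ⥤ Y.Obj)
    (hF : ∀ A, F.obj (X.M A) = Y.M A) : X ⟶ Y where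
  functor := F
  map_M := hF
  preservesFiniteProducts := preservesFiniteProducts_of_isThin F hF
  preservesFiniteCoproducts := preservesFiniteCoproducts_of_isThin F hF
  map_exponential := map_isExponential_of_isThin F hF
  map_terminal := mapForall_isTerminal F hF
  map_initial := mapExists_isInitial F hF

/-- Surjectivity of `X.M` fixes the object map, thinness the arrow map. The functor laws of `LD`
follow. -/
theorem hom_ext_of_isThin [Quiver.IsThin Y.Obj] (F G : X ⟶ Y) : F = G := by
  apply Hom.ext
  refine CategoryTheory.Functor.ext (fun A => ?_) fun _ _ _ => Subsingleton.elim _ _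
  obtain ⟨φ, rfl⟩ := X.surjective A
  rw [F.map_M, G.map_M]

end SigmaStr

end ThinFunctor

/-! ### The category of a structure, and the functor `LD` -/

section AssociatedCategory

variable {C : Type u} [Category.{v} C] [HeytingCategory C] {Sg : LogicalSignature.{w}}

namespace HStructure

variable (M : HStructure C Sg)

/-- A λ-type chosen to name the sub-object in context `⟦FV(φ). φ⟧`. -/
noncomputable def rep (φ : LType Sg) : LType Sg :=
  Set.rangeSplitting M.interpFV ⟨M.interpFV φ, φ, rfl⟩

theorem interpFV_rep (φ : LType Sg) : M.interpFV (M.rep φ) = M.interpFV φ :=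
  Set.apply_rangeSplitting _ _

variable {M} in
theorem rep_eq_rep {φ ψ : LType Sg} (h : M.interpFV φ = M.interpFV ψ) : M.rep φ = M.rep ψ := by
  simp only [rep, h]

variable {M}

/-- The preorder category, under entailment, of the chosen names. -/
abbrev repCategory (hM : IsInhabited C Sg M) : Category.{r} (Set.range M.rep) where
  Hom A B := ULift.{r} (PLift (M.Entails A.1 B.1))
  id A := ⟨⟨.refl A.1⟩⟩
  comp f g := ⟨⟨f.down.down.trans hM g.down.down⟩⟩
  id_comp _ := Subsingleton.elim (α := ULift (PLift _)) _ _
  comp_id _ := Subsingleton.elim (α := ULift (PLift _)) _ _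
  assoc _ _ _ := Subsingleton.elim (α := ULift (PLift _)) _ _

theorem repCategory_isThin (hM : IsInhabited C Sg M) :
    @Quiver.IsThin (Set.range M.rep) (repCategory.{u, v, w, r} hM).toQuiver :=
  fun A B => inferInstanceAs (Subsingleton (ULift (PLift (M.Entails A.1 B.1))))

/-- A formula and its chosen name have the same interpretation, so they entail each other. -/
theorem nonempty_repCategory_hom_iff (hM : IsInhabited C Sg M) (φ ψ : LType Sg) :
    Nonempty ((repCategory.{u, v, w, r} hM).Hom ⟨M.rep φ, φ, rfl⟩ ⟨M.rep ψ, ψ, rfl⟩) ↔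
      M.Entails φ ψ :=
  ⟨fun ⟨h⟩ => ((Entails.of_interpFV_eq (M.interpFV_rep φ).symm).trans hM h.down.down).trans hM
      (.of_interpFV_eq (M.interpFV_rep ψ)),
    fun h => ⟨ULift.up (PLift.up (((Entails.of_interpFV_eq (M.interpFV_rep φ)).trans hM h).trans hM
      (.of_interpFV_eq (M.interpFV_rep ψ).symm)))⟩⟩

theorem rangeFactorization_rep_surjective :
    Function.Surjective fun φ => (⟨M.rep φ, φ, rfl⟩ : Set.range M.rep) := by
  rintro ⟨_, φ, rfl⟩
  exact ⟨φ, rfl⟩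

/-- The logically distributive category associated with a structure. -/
noncomputable def toSigmaStr (hM : IsInhabited C Sg M) : SigmaStr.{w, r} Sg where
  Obj := Set.range M.rep
  cat := repCategory hM
  M φ := ⟨M.rep φ, φ, rfl⟩
  surjective := rangeFactorization_rep_surjective
  isLogicallyDistributive :=
    letI := repCategory.{u, v, w, r} hM
    haveI := repCategory_isThin hM
    isLogicallyDistributive_of_entails hM rangeFactorization_rep_surjective
      (nonempty_repCategory_hom_iff hM)

/-- The objects of the associated category are the sub-objects in context `⟦FV(φ). φ⟧`. -/
noncomputable def toSigmaStrEquiv (hM : IsInhabited C Sg M) :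
    (toSigmaStr.{u, v, w, r} hM).Obj ≃ Set.range M.interpFV where
  toFun A := ⟨M.interpFV A.1, A.1, rfl⟩
  invFun c := ⟨Set.rangeSplitting M.interpFV c, by
    obtain ⟨_, φ, rfl⟩ := c
    exact Set.mem_range_self φ⟩
  left_inv := by
    rintro ⟨_, φ, rfl⟩
    exact Subtype.ext (rep_eq_rep (M.interpFV_rep φ))
  right_inv c := Subtype.ext (Set.apply_rangeSplitting M.interpFV c)

instance (hM : IsInhabited C Sg M) : Quiver.IsThin (toSigmaStr.{u, v, w, r} hM).Obj :=
  repCategory_isThin hM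

theorem toSigmaStr_isAssociated (hM : IsInhabited C Sg M) :
    IsAssociated M (toSigmaStr.{u, v, w, r} hM) (toSigmaStrEquiv hM) where
  map_M φ := M.interpFV_rep φ
  thin := repCategory_isThin hM
  nonempty_hom_iff := nonempty_repCategory_hom_iff hM

variable {N : HStructure C Sg}

theorem Hom.mapCtxSub_interpFV (h : Hom M N) (φ : LType Sg) :
    h.mapCtxSub (M.interpFV φ) = N.interpFV φ := by
  simp only [mapCtxSub, interpFV, h.map_interp]

theorem mapCtx_mono (F : C ⥤ C) [PreservesFiniteLimits F]
    (hF : ∀ s, F.obj (M.sort s) = N.sort s) {Γ : Finset (TVar Sg.Srt)}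
    {A B : Subobject (M.ctx Γ)} (h : A ≤ B) :
    mapCtx (N := N) F hF A ≤ mapCtx (N := N) F hF B :=
  Subobject.mk_le_mk_of_comm (F.map (Subobject.ofLE A B h)) (by simp [← Functor.map_comp_assoc])

/-- Both interpretations in the common context are preserved by `h`, and `mapCtx` is monotone. -/
theorem Entails.map {φ ψ : LType Sg} (hφψ : M.Entails φ ψ) (h : Hom M N) : N.Entails φ ψ := by
  rw [Entails, ← h.map_interp, ← h.map_interp]
  exact mapCtx_mono _ _ hφψ

/-- This makes the induced object map independent of the name chosen for a sub-object. -/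
theorem interpFV_eq_of_hom (h : Hom M N) {φ ψ : LType Sg} (hφψ : M.interpFV φ = M.interpFV ψ) :
    N.interpFV φ = N.interpFV ψ := by
  rw [← h.mapCtxSub_interpFV, hφψ, h.mapCtxSub_interpFV]

/-- The Σ-homomorphism between associated categories induced by a Σ-H-homomorphism. -/
noncomputable def toSigmaStrMap (hM : IsInhabited C Sg M) (hN : IsInhabited C Sg N)
    (h : Hom M N) : toSigmaStr.{u, v, w, r} hM ⟶ toSigmaStr.{u, v, w, r} hN :=
  SigmaStr.homOfIsThin
    { obj := fun A => (toSigmaStr.{u, v, w, r} hN).M A.1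
      map := fun {A B} f => ((nonempty_repCategory_hom_iff hN A.1 B.1).2
        (Entails.map (φ := A.1) (ψ := B.1) f.down.down h)).some
      map_id := fun _ => Subsingleton.elim _ _
      map_comp := fun _ _ => Subsingleton.elim _ _ }
    fun φ => Subtype.ext (rep_eq_rep (interpFV_eq_of_hom h (M.interpFV_rep φ)))

end HStructure

/-- The functor `LD` from structures with inhabited sorts to logically distributive categories. -/
noncomputable def logDistFunctor (C : Type u) [Category.{v} C] [HeytingCategory C]
    (Sg : LogicalSignature.{w}) :
    (HStructure.IsInhabited C Sg).FullSubcategory ⥤ SigmaStr.{w, r} Sg where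
  obj M := HStructure.toSigmaStr.{u, v, w, r} M.property
  map {M N} h := HStructure.toSigmaStrMap M.property N.property h.hom
  map_id M := SigmaStr.hom_ext_of_isThin (Y := HStructure.toSigmaStr M.property) _ _
  map_comp {_ _ P} _ _ := SigmaStr.hom_ext_of_isThin (Y := HStructure.toSigmaStr P.property) _ _

end AssociatedCategory

/-- `LD` is a functor from `Σ-H-Str(C)` to `Σ-Str`: on objects it is the associated logically
distributive category; on arrows, `LD(h)` sends the object `⟦FV(φ). φ⟧_M` to `h(⟦FV(φ). φ⟧_M)`
(and, hom-sets having at most one element, `⟦φ⟧_M ≤ ⟦ψ⟧_M` to `h(⟦φ⟧_M) ≤ h(⟦ψ⟧_M)`). -/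
theorem proposition8p20 {C : Type u} [Category.{v} C] [HeytingCategory C]
    (Sg : LambdaSignature.{w}) :
    ∃ (LD : (HStructure.IsInhabited C Sg.toLogicalSignature).FullSubcategory ⥤
        SigmaStr.{w, r} Sg.toLogicalSignature)
      (e : ∀ M, (LD.obj M).Obj ≃ Set.range M.obj.interpFV),
      (∀ M, HStructure.IsAssociated M.obj (LD.obj M) (e M)) ∧
      ∀ {M N} (h : M ⟶ N) (A : (LD.obj M).Obj),
        (e N ((LD.map h).functor.obj A)).1 = HStructure.Hom.mapCtxSub h.hom (e M A).1 := by
  refine ⟨logDistFunctor C Sg.toLogicalSignature,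
    fun M => HStructure.toSigmaStrEquiv M.property,
    fun M => HStructure.toSigmaStr_isAssociated M.property, fun {M N} h A => ?_⟩
  -- Both sides are the interpretation in `N` of the name `A.1`.
  exact (N.obj.interpFV_rep A.1).trans (HStructure.Hom.mapCtxSub_interpFV h.hom A.1).symm
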